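/- Notation. For $n\in\mathbb N$ let $[n]=\{1,\dots,n\}$. Let $a,b$ be positive integers, let $l$ be a nonnegative integer, and let $\alpha=\{\alpha_1<\dots<\alpha_r\}\subseteq[a]$ and $\beta=\{\beta_1<\dots<\beta_r\}\subseteq[b]$ have equal cardinality $r\ge 0$. Paths. Points of $[a]\times[b]$ are written $(i,j)$, with $i$ the row (rows numbered from top to bottom) and $j$ the column. Let $\Pi(a,b,\alpha_k,\beta_k)$ be the set of lattice paths from $(a,\beta_k)$ to $(\alpha_k,b)$ all of whose steps are $(0,1)$ or $(-1,0)$. For $k<k'$, paths $P\in\Pi(a,b,\alpha_k,\beta_k)$ and $P'\in\Pi(a,b,\alpha_{k'},\beta_{k'})$ are osculating if, at each of their common points $(i,j)$, $P$ comes from $(i,j-1)$ and continues to $(i-1,j)$, while $P'$ comes from $(i+1,j)$ (unless it starts at $(i,j)$) and continues to $(i,j+1)$ (unless it ends at $(i,j)$). Let $OP(a,b,\alpha,\beta)$ be the set of tuples $(P_1,\dots,P_r)$ with $P_k\in\Pi(a,b,\alpha_k,\beta_k)$ for each $k\in[r]$ such that $P_k$ and $P_{k+1}$ are osculating for each $k\in[r-1]$.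 A vacancy-osculation of such a tuple is a point of $[a]\times[b]$ that lies on none of its paths or on at least two of them. Let $OP(a,b,\alpha,\beta,l)$ be the set of tuples in $OP(a,b,\alpha,\beta)$ with exactly $l$ vacancy-osculations. The partition. Let $\mu=(b-\beta_1,\dots,b-\beta_r\,|\,a-\alpha_1,\dots,a-\alpha_r)$ in Frobenius notation, i.e. $\mu$ is the partition with exactly $r$ squares on the main diagonal of its Young diagram, whose $k$-th diagonal square has $b-\beta_k$ squares to its right in its row and $a-\alpha_k$ squares below it in its column. Let $\lambda=\lambda_{a,b,\alpha,\beta}=(b-\mu_a,b-\mu_{a-1},\dots,b-\mu_1)$. Oscillating tableaux. Let $OT(\lambda,l)$ be the set of sequences $\eta=(\emptyset=\eta_0,\eta_1,\dots,\eta_l=\lambda)$ of partitions such that, for each $k\in[l]$, the Young diagram of one of $\eta_{k-1},\eta_k$ is obtained from that of the other by adding a single square; let $\Omega(\eta)_k=j-i$, where $(i,j)$ (row $i$, column $j$) is that square. For a strict total order $\prec$ on $\mathbb Z$, let $\mathrm{asc}(\prec,\eta)$ be the number of $k$ with $1\le k\le l-1$ and $\Omega(\eta)_k\prec\Omega(\eta)_{k+1}$.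 Statement. If $\alpha=[a]$, then $$|OP(a,b,[a],\beta,l)|=\sum_{\eta\in OT(\lambda,l)}\binom{a+\mathrm{asc}(<,\eta)}{l},\qquad \lambda=\lambda_{a,b,[a],\beta}.$$ If $\beta=[b]$, then $$|OP(a,b,\alpha,[b],l)|=\sum_{\eta\in OT(\lambda,l)}\binom{b+\mathrm{asc}(>,\eta)}{l},\qquad \lambda=\lambda_{a,b,\alpha,[b]}.$$ Here $<$ and $>$ are the usual orders on $\mathbb Z$; all the sets involved are finite. -/

import Mathlib

namespace OscPaths

/-! ### Boundary points and osculating paths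

Points of the lattice are pairs `(row, column)` in `ℤ × ℤ`; rows are numbered from top to bottom. -/

/-- Pairs `(α, β)` of boundary points: `α ⊆ [a]`, `β ⊆ [b]`, `|α| = |β|`. -/
structure BP (a b : ℕ) where
  α : Finset ℕ
  β : Finset ℕ
  α_sub : α ⊆ Finset.Icc 1 a
  β_sub : β ⊆ Finset.Icc 1 b
  card_eq : α.card = β.card

namespace BP

variable {a b : ℕ}

/-- The common cardinality `r` of `α` and `β`. -/
def r (p : BP a b) : ℕ := p.α.card

/-- The elements `α_1 < ... < α_r` of `α` in increasing order (indexed from `0`). -/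
def αAt (p : BP a b) : Fin p.r ↪o ℕ := p.α.orderEmbOfFin rfl

/-- The elements `β_1 < ... < β_r` of `β` in increasing order (indexed from `0`). -/
def βAt (p : BP a b) : Fin p.r ↪o ℕ := p.β.orderEmbOfFin p.card_eq.symm

theorem αAt_le (p : BP a b) (k : Fin p.r) : p.αAt k ≤ a :=
  (Finset.mem_Icc.1 (p.α_sub (Finset.orderEmbOfFin_mem _ _ k))).2

theorem βAt_le (p : BP a b) (k : Fin p.r) : p.βAt k ≤ b :=
  (Finset.mem_Icc.1 (p.β_sub (Finset.orderEmbOfFin_mem _ _ k))).2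

end BP

/-- A single step of a path: rightwards `(0,1)` or upwards `(-1,0)`. -/
def IsStep (u v : ℤ × ℤ) : Prop := v - u = (0, 1) ∨ v - u = (-1, 0)

/-- `Π(a,b,α,β)`: lattice paths from `(a,β)` to `(α,b)`, as the list of points visited. -/
def latticePaths (a b α β : ℕ) : Set (List (ℤ × ℤ)) :=
  {P | P.head? = some ((a : ℤ), (β : ℤ)) ∧ P.getLast? = some ((α : ℤ), (b : ℤ)) ∧
    P.IsChain IsStep}

/-- The paths `P` and `Q` (with `P` starting to the left of, and ending above, `Q`) are osculating:
at every common point `(i,j)`, `P` arrives from `(i,j-1)` and leaves to `(i-1,j)`, while `Q` arrives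
from `(i+1,j)` (unless it starts there) and leaves to `(i,j+1)` (unless it ends there). -/
def Osculating (P Q : List (ℤ × ℤ)) : Prop :=
  ∀ (m n : ℕ) (i j : ℤ), P[m]? = some (i, j) → Q[n]? = some (i, j) →
    (m ≠ 0 ∧ P[m - 1]? = some (i, j - 1)) ∧ P[m + 1]? = some (i - 1, j) ∧
    (n ≠ 0 → Q[n - 1]? = some (i + 1, j)) ∧
    (n + 1 ≠ Q.length → Q[n + 1]? = some (i, j + 1))

/-- `OP(a,b,α,β)`: the `r`-tuples of lattice paths, the `k`-th in `Π(a,b,α_k,β_k)`, in which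
consecutive paths are osculating. -/
def OP {a b : ℕ} (p : BP a b) : Set (Fin p.r → List (ℤ × ℤ)) :=
  {P | (∀ k, P k ∈ latticePaths a b (p.αAt k) (p.βAt k)) ∧
    ∀ k k' : Fin p.r, (k' : ℕ) = k + 1 → Osculating (P k) (P k')}

/-- The rectangle `[a] × [b]`. -/
noncomputable def rect (a b : ℕ) : Finset (ℤ × ℤ) := Finset.Icc 1 (a : ℤ) ×ˢ Finset.Icc 1 (b : ℤ)

/-- `N(P)`: the vacancies, i.e. the points of `[a] × [b]` through which no path passes. -/
noncomputable def vacancies (a b : ℕ) {r : ℕ} (P : Fin r → List (ℤ × ℤ)) : Finset (ℤ × ℤ) :=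
  (rect a b).filter fun x => ∀ k, x ∉ P k

/-- `X(P)`: the osculations, i.e. the points common to two different paths of the tuple. -/
noncomputable def osculations (a b : ℕ) {r : ℕ} (P : Fin r → List (ℤ × ℤ)) : Finset (ℤ × ℤ) :=
  (rect a b).filter fun x => ∃ k k', k ≠ k' ∧ x ∈ P k ∧ x ∈ P k'

/-- `Z(P) = N(P) ∪ X(P)`: the vacancy-osculation set. -/
noncomputable def vacOsc (a b : ℕ) {r : ℕ} (P : Fin r → List (ℤ × ℤ)) : Finset (ℤ × ℤ) :=
  vacancies a b P ∪ osculations a b P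

/-- `OP(a,b,α,β,l)`: the elements of `OP(a,b,α,β)` with exactly `l` vacancy-osculations. -/
def OPl {a b : ℕ} (p : BP a b) (l : ℕ) : Set (Fin p.r → List (ℤ × ℤ)) :=
  {P | P ∈ OP p ∧ (vacOsc a b P).card = l}

/-! ### Partitions

Partitions are represented by their Young diagrams (whose rows and columns are numbered from `0`,
which does not affect contents). -/

/-- The partition `(γ_1,...,γ_r | δ_1,...,δ_r)` in Frobenius notation: the union over `k` of the
hooks with corner at the `k`-th diagonal square, arm length `γ_k` and leg length `δ_k`. -/
def frobenius {r : ℕ} (γ δ : Fin r → ℕ) (hγ : StrictAnti γ) (hδ : StrictAnti δ) :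
    YoungDiagram where
  cells := Finset.univ.biUnion fun k : Fin r =>
    (Finset.range (γ k + 1)).image (fun m => ((k : ℕ), (k : ℕ) + m)) ∪
      (Finset.range (δ k + 1)).image (fun m => ((k : ℕ) + m, (k : ℕ)))
  isLowerSet := by
    have key : ∀ f : Fin r → ℕ, StrictAnti f → ∀ k i : ℕ, ∀ (hk : k < r) (hi : i ≤ k),
        f ⟨k, hk⟩ + k ≤ f ⟨i, lt_of_le_of_lt hi hk⟩ + i := by
      intro f hf k
      induction k with
      | zero =>
        intro i hk hi
        obtain rfl : i = 0 := by omega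
        exact le_rfl
      | succ n ih =>
        intro i hk hi
        rcases Nat.lt_or_ge n i with h | h
        · obtain rfl : i = n + 1 := by omega
          exact le_rfl
        · have h1 := ih i (by omega) h
          have h2 : f ⟨n + 1, hk⟩ < f ⟨n, by omega⟩ := hf (Fin.mk_lt_mk.2 (Nat.lt_succ_self n))
          omega
    rintro ⟨x, y⟩ ⟨i, j⟩ hle hmem
    obtain ⟨hi, hj⟩ : i ≤ x ∧ j ≤ y := Prod.mk_le_mk.1 hle
    simp only [Finset.coe_biUnion, Finset.coe_univ, Set.mem_univ, Set.iUnion_true, Set.mem_iUnion,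
      Finset.mem_coe, Finset.mem_union, Finset.mem_image, Finset.mem_range, Prod.mk.injEq] at hmem ⊢
    obtain ⟨⟨k, hk⟩, h⟩ := hmem
    rcases le_total i j with hij | hij
    · have hik : i ≤ k := by rcases h with ⟨m, -, h1, h2⟩ | ⟨m, -, h1, h2⟩ <;> simp at h1 h2 <;> omega
      have h3 := key γ hγ k i hk hik
      refine ⟨⟨i, by omega⟩, Or.inl ⟨j - i, ?_, rfl, by simp; omega⟩⟩
      rcases h with ⟨m, h0, h1, h2⟩ | ⟨m, h0, h1, h2⟩ <;> simp at h1 h2 <;> omega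
    · have hjk : j ≤ k := by rcases h with ⟨m, -, h1, h2⟩ | ⟨m, -, h1, h2⟩ <;> simp at h1 h2 <;> omega
      have h3 := key δ hδ k j hk hjk
      refine ⟨⟨j, by omega⟩, Or.inr ⟨i - j, ?_, by simp; omega, rfl⟩⟩
      rcases h with ⟨m, h0, h1, h2⟩ | ⟨m, h0, h1, h2⟩ <;> simp at h1 h2 <;> omega

/-- The `(a,b)`-complement `(b - μ_a, b - μ_{a-1}, ..., b - μ_1)` of a partition `μ` whose diagram
fits into an `a` by `b` rectangle. -/
def complement (a b : ℕ) (μ : YoungDiagram) : YoungDiagram where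
  cells := (Finset.range a ×ˢ Finset.range b).filter fun c => c.2 < b - μ.rowLen (a - 1 - c.1)
  isLowerSet := by
    rintro ⟨x, y⟩ ⟨i, j⟩ hle hmem
    obtain ⟨hi, hj⟩ : i ≤ x ∧ j ≤ y := Prod.mk_le_mk.1 hle
    simp only [Finset.mem_coe, Finset.mem_filter, Finset.mem_product, Finset.mem_range] at hmem ⊢
    have := μ.rowLen_anti (a - 1 - x) (a - 1 - i) (by omega)
    omega

/-- The partition `λ_{a,b,α,β}`, the `(a,b)`-complement of
`(b - β_1, ..., b - β_r | a - α_1, ..., a - α_r)`. -/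
def BP.toPartition {a b : ℕ} (p : BP a b) : YoungDiagram :=
  complement a b (frobenius (fun k => b - p.βAt k) (fun k => a - p.αAt k)
    (fun k k' h => by
      have h1 := p.βAt.strictMono h
      have h2 := p.βAt_le k'
      simp only
      omega)
    (fun k k' h => by
      have h1 := p.αAt.strictMono h
      have h2 := p.αAt_le k'
      simp only
      omega))

/-- `μ ∼ ν`: the partitions `μ` and `ν` differ by a square. -/
def DiffBySquare (μ ν : YoungDiagram) : Prop :=
  ∃ c : ℕ × ℕ, (c ∉ ν.cells ∧ μ.cells = insert c ν.cells) ∨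
    (c ∉ μ.cells ∧ ν.cells = insert c μ.cells)

/-- The diagonal difference `Δ(μ,ν)` of partitions with `μ ∼ ν`: the content (column minus row) of
the square by which they differ. That square is then the only element of the symmetric difference
of the diagrams, so that the sum has a single term. -/
def diagDiff (μ ν : YoungDiagram) : ℤ :=
  ∑ c ∈ symmDiff μ.cells ν.cells, ((c.2 : ℤ) - (c.1 : ℤ))

/-! ### Oscillating tableaux -/

/-- `OT(μ,l)`: the oscillating tableaux of shape `μ` and length `l`. -/
def OT (μ : YoungDiagram) (l : ℕ) : Set (Fin (l + 1) → YoungDiagram) :=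
  {η | η 0 = ⊥ ∧ η (Fin.last l) = μ ∧ ∀ k : Fin l, DiffBySquare (η k.castSucc) (η k.succ)}

/-- The profile `Ω(η)`: the sequence of the diagonal differences between successive partitions
(indexed from `0`). -/
def profile {l : ℕ} (η : Fin (l + 1) → YoungDiagram) (k : Fin l) : ℤ :=
  diagDiff (η k.castSucc) (η k.succ)

/-- The number of ascents of `η` with respect to the order `rel`: the number of indices at which the
profile and its successor are related by `rel`. -/
def asc (rel : ℤ → ℤ → Prop) [DecidableRel rel] {l : ℕ} (η : Fin (l + 1) → YoungDiagram) : ℕ :=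
  (Finset.univ.filter fun k : Fin (l - 1) =>
    rel (profile η ⟨(k : ℕ), by omega⟩) (profile η ⟨(k : ℕ) + 1, by omega⟩)).card

end OscPaths

/-!
A tuple of osculating paths is encoded by its height function `H i j`, the number of paths that have
a point weakly above and weakly to the left of `(i, j)`. In terms of the row `R k c` of the `k`-th
path at content `c` (column minus row), osculation says `R k (c - 1) ≤ R (k + 1) c` and
`R k (c + 1) < R (k + 1) c`, while `k < H i j` is equivalent to `R k (j - i) ≤ i` wherever the latter
makes sense. Under this duality the osculating tuples correspond to all functions `H` that grow by
`0` or `1` in each coordinate direction and have the prescribed boundary values (`height_bijOn`).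
The vacancy-osculations are the points of the rectangle where `H i j - H (i - 1) (j - 1)` is not `1`.

Consequently `min i j - H i j` changes along a diagonal by `1` at a vacancy, by `-1` at an
osculation, and not at all elsewhere. These numbers are the sizes of the diagonals of Young diagrams:
if the points of the rectangle are visited row by row, then every vacancy of content `c` adds
a square of content `c` to the diagram obtained so far, every osculation removes one, and one passes
from the empty diagram to `λ`. This is an oscillating tableau of shape `λ` together with the sequence
of the rows in which its steps happen; the pairs of a row and a content must increase
lexicographically (`chainOfTableau_bijOn`). Conversely such a pair determines a height function. The
columns of its steps automatically lie between `1` and `b` when `α = [a]`: in a column `j ≤ 0` the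
diagonal sizes weakly decrease from `0` going down, and in a column `j ≥ b` they weakly increase
to `0`, so that they vanish in both cases (`IsPartitionChain.eq_zero_left` and
`IsPartitionChain.eq_zero_right`).

For a fixed tableau, adding to each row number the number of earlier ascents turns the compatible
sequences of rows into the strictly increasing sequences with values from `1` to `a + asc`, of which
there are `(a + asc).choose l` (`ncard_rowSeqs`). The case `β = [b]` follows by transposing height
functions and Young diagrams.
-/

namespace OscPaths

/-! ### Initial segments -/

/-- A decreasing predicate on `Fin r` is determined by the number of indices that satisfy it. -/
theorem iff_lt_card_filter {r : ℕ} (A : Fin r → Prop) [DecidablePred A]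
    (hA : ∀ k k', k ≤ k' → A k' → A k) (k : Fin r) :
    A k ↔ (k : ℕ) < (Finset.univ.filter A).card := by
  constructor
  · intro h
    have h1 : Finset.Iic k ⊆ Finset.univ.filter A := fun x hx => by
      simpa using hA x k (Finset.mem_Iic.1 hx) h
    have h2 := Finset.card_le_card h1
    rw [Fin.card_Iic] at h2
    omega
  · intro h
    by_contra hk
    have h1 : Finset.univ.filter A ⊆ Finset.Iio k := fun x hx => by
      rw [Finset.mem_Iio]
      by_contra hxk
      exact hk (hA k x (not_lt.1 hxk) (Finset.mem_filter.1 hx).2)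
    have h2 := Finset.card_le_card h1
    rw [Fin.card_Iio] at h2
    omega

/-- The number of elements of `s` that are at most `x`. -/
def countLE (s : Finset ℕ) (x : ℤ) : ℕ := (s.filter fun n : ℕ => (n : ℤ) ≤ x).card

theorem orderEmbOfFin_le_iff (s : Finset ℕ) {r : ℕ} (h : s.card = r) (k : Fin r) (x : ℤ) :
    ((s.orderEmbOfFin h k : ℕ) : ℤ) ≤ x ↔ (k : ℕ) < countLE s x := by
  have h1 := iff_lt_card_filter (fun k : Fin r => ((s.orderEmbOfFin h k : ℕ) : ℤ) ≤ x)
    (fun k k' hk hx => by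
      have := (s.orderEmbOfFin h).monotone hk
      omega) k
  rw [h1]
  have h2 : countLE s x =
      (Finset.univ.filter fun k : Fin r => ((s.orderEmbOfFin h k : ℕ) : ℤ) ≤ x).card := by
    rw [countLE, ← Finset.card_map (s.orderEmbOfFin h).toEmbedding]
    congr 1
    ext n
    simp only [Finset.mem_filter, Finset.mem_map, Finset.mem_univ, true_and]
    constructor
    · rintro ⟨hn, hx⟩
      have : n ∈ Set.range (s.orderEmbOfFin h) := by simpa using hn
      obtain ⟨k, rfl⟩ := this
      exact ⟨k, hx, rfl⟩
    · rintro ⟨k, hx, rfl⟩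
      exact ⟨Finset.orderEmbOfFin_mem _ _ _, hx⟩
  rw [h2]

theorem countLE_zero {s : Finset ℕ} {n : ℕ} (hs : s ⊆ Finset.Icc 1 n) {x : ℤ} (hx : x ≤ 0) :
    countLE s x = 0 := by
  rw [countLE, Finset.card_eq_zero, Finset.filter_eq_empty_iff]
  intro m hm
  have := (Finset.mem_Icc.1 (hs hm)).1
  omega

theorem countLE_top {s : Finset ℕ} {n : ℕ} (hs : s ⊆ Finset.Icc 1 n) {x : ℤ} (hx : (n : ℤ) ≤ x) :
    countLE s x = s.card := by
  rw [countLE, Finset.filter_true_of_mem]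
  intro m hm
  have := (Finset.mem_Icc.1 (hs hm)).2
  omega

theorem countLE_Icc (a : ℕ) {x : ℤ} (h0 : 0 ≤ x) (hx : x ≤ a) :
    (countLE (Finset.Icc 1 a) x : ℤ) = x := by
  have : (Finset.Icc 1 a).filter (fun n : ℕ => (n : ℤ) ≤ x) = Finset.Icc 1 x.toNat := by
    ext n
    simp only [Finset.mem_filter, Finset.mem_Icc]
    omega
  rw [countLE, this, Nat.card_Icc]
  omega

namespace BP
variable {a b : ℕ} (p : BP a b)

theorem βAt_le_iff (k : Fin p.r) (x : ℤ) : (p.βAt k : ℤ) ≤ x ↔ (k : ℕ) < countLE p.β x :=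
  orderEmbOfFin_le_iff _ _ _ _

theorem αAt_le_iff (k : Fin p.r) (x : ℤ) : (p.αAt k : ℤ) ≤ x ↔ (k : ℕ) < countLE p.α x :=
  orderEmbOfFin_le_iff _ _ _ _

theorem one_le_αAt (k : Fin p.r) : 1 ≤ p.αAt k :=
  (Finset.mem_Icc.1 (p.α_sub (Finset.orderEmbOfFin_mem _ _ k))).1

theorem one_le_βAt (k : Fin p.r) : 1 ≤ p.βAt k :=
  (Finset.mem_Icc.1 (p.β_sub (Finset.orderEmbOfFin_mem _ _ k))).1

end BP

/-! ### Lattice paths as functions of the content -/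

/-- The list of the points of contents `s, s + 1, ..., s + n` of a path that is in row `R c` when
its content (column minus row) is `c`. -/
def pathOf (s : ℤ) (n : ℕ) (R : ℤ → ℤ) : List (ℤ × ℤ) :=
  (List.range (n + 1)).map fun m : ℕ => (R (s + m), R (s + m) + (s + m))

/-- In passing from a content in `[s, t)` to the next, a path in row `R c` at content `c` makes
a step rightwards or upwards. -/
def StepsOn (s t : ℤ) (R : ℤ → ℤ) : Prop :=
  ∀ c, s ≤ c → c < t → R (c + 1) = R c ∨ R (c + 1) = R c - 1

theorem pathOf_getElem? (s : ℤ) (n : ℕ) (R : ℤ → ℤ) (m : ℕ) (x y : ℤ) :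
    (pathOf s n R)[m]? = some (x, y) ↔ m ≤ n ∧ y - x = s + m ∧ R (y - x) = x := by
  simp only [pathOf, List.getElem?_map, Option.map_eq_some_iff, List.getElem?_eq_some_iff,
    List.length_range, List.getElem_range, Prod.mk.injEq]
  constructor
  · rintro ⟨_, ⟨h, rfl⟩, rfl, rfl⟩
    simp only [add_sub_cancel_left, and_true]
    omega
  · rintro ⟨h, h1, h2⟩
    rw [h1] at h2
    exact ⟨m, ⟨by omega, rfl⟩, h2, by rw [h2]; omega⟩

theorem mem_pathOf (s : ℤ) (n : ℕ) (R : ℤ → ℤ) (x y : ℤ) :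
    (x, y) ∈ pathOf s n R ↔ s ≤ y - x ∧ y - x ≤ s + n ∧ R (y - x) = x := by
  rw [List.mem_iff_getElem?]
  simp only [pathOf_getElem?]
  constructor
  · rintro ⟨m, h1, h2, h3⟩
    exact ⟨by omega, by omega, h3⟩
  · rintro ⟨h1, h2, h3⟩
    exact ⟨(y - x - s).toNat, by omega, by omega, h3⟩

theorem pathOf_mem_latticePaths {a b α β : ℕ} {n : ℕ} (R : ℤ → ℤ) (s : ℤ) (hs : s = (β : ℤ) - a)
    (hn : s + n = (b : ℤ) - α) (h0 : R s = a) (h1 : R (s + n) = α)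
    (hR : StepsOn s (s + n) R) : pathOf s n R ∈ latticePaths a b α β := by
  refine ⟨?_, ?_, ?_⟩
  · rw [List.head?_eq_getElem?, pathOf_getElem?]
    have : (β : ℤ) - a = s := hs.symm
    rw [this]
    simp [h0]
  · rw [List.getLast?_eq_getElem?, pathOf_getElem?, ← hn, h1]
    simp [pathOf]
  · rw [pathOf, List.isChain_iff_getElem]
    intro i hi
    simp only [List.length_map, List.length_range] at hi
    simp only [List.getElem_map, List.getElem_range, IsStep]
    rcases hR (s + i) (by omega) (by omega) with h | h
    · left
      have : s + ((i + 1 : ℕ) : ℤ) = s + i + 1 := by push_cast; ring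
      rw [this, h]; ext <;> simp
    · right
      have : s + ((i + 1 : ℕ) : ℤ) = s + i + 1 := by push_cast; ring
      rw [this, h]; ext <;> simp

theorem exists_pathOf_of_mem_latticePaths {a b α β : ℕ} {P : List (ℤ × ℤ)}
    (hP : P ∈ latticePaths a b α β) : ∃ (n : ℕ) (R : ℤ → ℤ),
      (β : ℤ) - a + n = (b : ℤ) - α ∧ R ((β : ℤ) - a) = a ∧ R ((b : ℤ) - α) = α ∧
      StepsOn ((β : ℤ) - a) ((b : ℤ) - α) R ∧ P = pathOf ((β : ℤ) - a) n R := by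
  obtain ⟨h0, h1, h2⟩ := hP
  set s : ℤ := (β : ℤ) - a with hs
  have hstep : ∀ (m : ℕ) (h : m + 1 < P.length),
      (P[m + 1].1 = P[m].1 ∧ P[m + 1].2 = P[m].2 + 1) ∨
      (P[m + 1].1 = P[m].1 - 1 ∧ P[m + 1].2 = P[m].2) := by
    intro m h
    rw [List.isChain_iff_getElem] at h2
    have := h2 m h
    simp only [IsStep, Prod.ext_iff, Prod.fst_sub, Prod.snd_sub] at this
    omega
  have hne : 0 < P.length := by
    rcases P with _ | ⟨x, P⟩
    · simp at h0
    · simp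
  have h00 : P[0] = ((a : ℤ), (β : ℤ)) := by
    rw [List.head?_eq_getElem?, List.getElem?_eq_getElem hne] at h0
    simpa using h0
  have hll : P[P.length - 1] = ((α : ℤ), (b : ℤ)) := by
    rw [List.getLast?_eq_getElem?, List.getElem?_eq_getElem (by omega)] at h1
    simpa using h1
  have hc : ∀ (m : ℕ) (h : m < P.length), P[m].2 - P[m].1 = s + m := by
    intro m
    induction m with
    | zero => intro h; simp [h00, hs]
    | succ m ih =>
      intro h
      have := ih (by omega)
      have := hstep m h
      push_cast
      omega
  let R : ℤ → ℤ := fun c => (P.getD (c - s).toNat (0, 0)).1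
  have hR : ∀ (m : ℕ) (h : m < P.length), R (s + m) = P[m].1 := by
    intro m h
    simp only [R]
    have : (s + (m : ℤ) - s).toNat = m := by omega
    rw [this, List.getD_eq_getElem _ _ h]
  have hlen : s + ((P.length - 1 : ℕ) : ℤ) = (b : ℤ) - α := by
    have := hc (P.length - 1) (by omega)
    rw [hll] at this
    exact this.symm
  refine ⟨P.length - 1, R, hlen, ?_, ?_, ?_, ?_⟩
  · have := hR 0 hne
    simpa [h00] using this
  · rw [← hlen, hR _ (by omega), hll]
  · intro c hc1 hc2
    obtain ⟨m, hm⟩ : ∃ m : ℕ, c = s + m := ⟨(c - s).toNat, by omega⟩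
    subst hm
    have e : s + (m : ℤ) + 1 = s + ((m + 1 : ℕ) : ℤ) := by push_cast; ring
    rw [e, hR _ (by omega), hR _ (by omega)]
    have := hstep m (by omega)
    omega
  · apply List.ext_getElem
    · simp only [pathOf, List.length_map, List.length_range]; omega
    · intro m h h'
      have := hc m h
      simp only [pathOf, List.getElem_map, List.getElem_range]
      rw [hR m h]
      ext
      · rfl
      · simp only; omega

/-- For paths whose ranges of contents are nested strictly, the osculation condition only involves
their rows at equal and at neighbouring contents. -/
theorem osculating_pathOf_iff {s s' : ℤ} {n n' : ℕ} {R R' : ℤ → ℤ} (hs : s < s')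
    (ht : s' + n' < s + n) :
    Osculating (pathOf s n R) (pathOf s' n' R') ↔
      ∀ c, s' ≤ c → c ≤ s' + n' → R c = R' c → R (c - 1) = R c ∧ R (c + 1) = R c - 1 ∧
        (s' < c → R' (c - 1) = R' c + 1) ∧ (c < s' + n' → R' (c + 1) = R' c) := by
  simp only [Osculating, pathOf_getElem?]
  have hl : (pathOf s' n' R').length = n' + 1 := by simp [pathOf]
  rw [hl]
  constructor
  · intro H c hc1 hc2 he
    have := H (c - s).toNat (c - s').toNat (R c) (R c + c)
      (by simp only [add_sub_cancel_left]; refine ⟨by omega, by omega, trivial⟩)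
      (by simp only [add_sub_cancel_left]; refine ⟨by omega, by omega, he.symm⟩)
    obtain ⟨⟨-, -, -, h1⟩, ⟨-, -, h2⟩, h3, h4⟩ := this
    have e1 : R c + c - 1 - R c = c - 1 := by ring
    have e2 : R c + c - (R c - 1) = c + 1 := by ring
    have e3 : R c + c - (R c + 1) = c - 1 := by ring
    have e4 : R c + c + 1 - R c = c + 1 := by ring
    rw [e1] at h1
    rw [e2] at h2
    rw [e3] at h3
    rw [e4] at h4
    refine ⟨h1, h2, fun h => ?_, fun h => ?_⟩
    · rw [← he]; exact (h3 (by omega)).2.2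
    · rw [← he]; exact (h4 (by omega)).2.2
  · rintro H m k i j ⟨h1, h2, h3⟩ ⟨h4, h5, h6⟩
    obtain ⟨g1, g2, g3, g4⟩ := H (j - i) (by omega) (by omega) (by rw [h3, h6])
    have e1 : j - 1 - i = j - i - 1 := by ring
    have e2 : j - (i - 1) = j - i + 1 := by ring
    have e3 : j - (i + 1) = j - i - 1 := by ring
    have e4 : j + 1 - i = j - i + 1 := by ring
    rw [e1, e2, e3, e4]
    refine ⟨⟨by omega, by omega, by omega, by omega⟩, ⟨by omega, by omega, by omega⟩,
      fun h => ⟨by omega, by omega, ?_⟩, fun h => ⟨by omega, by omega, ?_⟩⟩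
    · rw [g3 (by omega), h6]
    · rw [g4 (by omega), h6]

end OscPaths

namespace OscPaths

/-! ### Osculating tuples and height functions -/

/-- Some point of the path `R`, with contents from `s` to `t`, lies weakly above and weakly to the
left of `(i, j)`. -/
def Covers (s t : ℤ) (R : ℤ → ℤ) (i j : ℤ) : Prop :=
  ∃ c, s ≤ c ∧ c ≤ t ∧ R c ≤ i ∧ R c + c ≤ j

theorem Covers.mono {s t : ℤ} {R : ℤ → ℤ} {i j i' j' : ℤ} (h : Covers s t R i j) (hi : i ≤ i')
    (hj : j ≤ j') : Covers s t R i' j' := by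
  obtain ⟨c, h1, h2, h3, h4⟩ := h
  exact ⟨c, h1, h2, by omega, by omega⟩

theorem StepsOn.anti {s t : ℤ} {R : ℤ → ℤ} (hR : StepsOn s t R) {c c' : ℤ} (h1 : s ≤ c)
    (h2 : c ≤ c') (h3 : c' ≤ t) : R c' ≤ R c ∧ R c + c ≤ R c' + c' := by
  induction c', h2 using Int.leInduction with
  | base => exact ⟨le_rfl, le_rfl⟩
  | succ d hd ih =>
    have := ih (by omega)
    have := hR d (by omega) (by omega)
    omega

theorem StepsOn.covers_iff {s t : ℤ} {R : ℤ → ℤ} (hR : StepsOn s t R) {i j : ℤ} (h1 : s ≤ j - i)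
    (h2 : j - i ≤ t) : Covers s t R i j ↔ R (j - i) ≤ i := by
  constructor
  · rintro ⟨c, h3, h4, h5, h6⟩
    rcases le_total c (j - i) with h | h
    · have := hR.anti h3 h h2
      omega
    · have := hR.anti h1 h h4
      omega
  · intro h
    exact ⟨j - i, h1, h2, h, by omega⟩

/-- The row of a path at a given content is the place where `Covers` starts to hold along the
diagonal of that content. -/
theorem StepsOn.row_eq_iff {s t : ℤ} {R : ℤ → ℤ} (hR : StepsOn s t R) {i j : ℤ} (h1 : s ≤ j - i)
    (h2 : j - i ≤ t) :
    R (j - i) = i ↔ Covers s t R i j ∧ ¬ Covers s t R (i - 1) (j - 1) := by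
  have e : j - 1 - (i - 1) = j - i := by ring
  rw [hR.covers_iff h1 h2, hR.covers_iff (by omega) (by omega), e]
  omega

variable {a b : ℕ}

/-- The first content of the `k`-th path. -/
def BP.s (p : BP a b) (k : Fin p.r) : ℤ := (p.βAt k : ℤ) - a

/-- The last content of the `k`-th path. -/
def BP.t (p : BP a b) (k : Fin p.r) : ℤ := (b : ℤ) - p.αAt k

theorem BP.s_le_t (p : BP a b) (k : Fin p.r) : p.s k ≤ p.t k := by
  have h1 := p.αAt_le k
  have h2 := p.βAt_le k
  unfold BP.s BP.t
  omega

theorem BP.s_lt (p : BP a b) {k k' : Fin p.r} (h : k < k') : p.s k < p.s k' := by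
  have := p.βAt.strictMono h
  unfold BP.s
  omega

theorem BP.t_lt (p : BP a b) {k k' : Fin p.r} (h : k < k') : p.t k' < p.t k := by
  have := p.αAt.strictMono h
  unfold BP.t
  omega

/-- The row functions of a tuple of osculating paths. -/
structure IsOscTuple (p : BP a b) (R : Fin p.r → ℤ → ℤ) : Prop where
  start : ∀ k, R k (p.s k) = a
  finish : ∀ k, R k (p.t k) = p.αAt k
  steps : ∀ k, StepsOn (p.s k) (p.t k) (R k)
  osc : ∀ k k' : Fin p.r, (k' : ℕ) = k + 1 → ∀ c, p.s k' ≤ c → c ≤ p.t k' →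
    R k (c - 1) ≤ R k' c ∧ R k (c + 1) + 1 ≤ R k' c

/-- The tuple of paths with given row functions. -/
def toPaths (p : BP a b) (R : Fin p.r → ℤ → ℤ) (k : Fin p.r) : List (ℤ × ℤ) :=
  pathOf (p.s k) (p.t k - p.s k).toNat (R k)

theorem mem_toPaths (p : BP a b) (R : Fin p.r → ℤ → ℤ) (k : Fin p.r) (x y : ℤ) :
    (x, y) ∈ toPaths p R k ↔ p.s k ≤ y - x ∧ y - x ≤ p.t k ∧ R k (y - x) = x := by
  have := p.s_le_t k
  rw [toPaths, mem_pathOf]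
  have e : p.s k + ((p.t k - p.s k).toNat : ℤ) = p.t k := by omega
  rw [e]

theorem mem_OP_iff (p : BP a b) (P : Fin p.r → List (ℤ × ℤ)) :
    P ∈ OP p ↔ ∃ R, IsOscTuple p R ∧ P = toPaths p R := by
  have hst : ∀ k, p.s k + ((p.t k - p.s k).toNat : ℤ) = p.t k := fun k => by
    have := p.s_le_t k
    omega
  constructor
  · rintro ⟨hP, ho⟩
    choose n R h1 h2 h3 h4 h5 using fun k => exists_pathOf_of_mem_latticePaths (hP k)
    replace h2 : ∀ k, R k (p.s k) = a := h2
    replace h3 : ∀ k, R k (p.t k) = p.αAt k := h3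
    replace h4 : ∀ k, StepsOn (p.s k) (p.t k) (R k) := h4
    have hn : ∀ k, n k = (p.t k - p.s k).toNat := fun k => by
      have := h1 k
      unfold BP.s BP.t
      omega
    have hP' : P = toPaths p R := by
      funext k
      rw [h5 k, hn k]
      rfl
    refine ⟨R, ⟨h2, h3, h4, ?_⟩, hP'⟩
    intro k k' hk
    have hlt : k < k' := Fin.lt_def.2 (by omega)
    have hs := p.s_lt hlt
    have ht := p.t_lt hlt
    have hosc := ho k k' hk
    rw [hP', toPaths, toPaths, osculating_pathOf_iff hs (by rw [hst, hst]; exact ht), hst] at hosc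
    -- The lower path never gets above the upper one, by induction along the lower path.
    have key : ∀ c, p.s k' ≤ c → c ≤ p.t k' → R k c ≤ R k' c := by
      intro c hc
      induction c, hc using Int.leInduction with
      | base =>
        intro _
        have := ((h4 k).anti le_rfl hs.le (by have := p.s_le_t k'; omega)).1
        have e1 := h2 k
        have e2 := h2 k'
        omega
      | succ c hc ih =>
        intro hc'
        have g1 := ih (by omega)
        have g2 := h4 k c (by omega) (by omega)
        have g3 := h4 k' c (by omega) (by omega)
        have g4 := hosc c hc (by omega)
        omega
    intro c hc hc'
    have g1 := key c hc hc'
    have g2 := h4 k c (by omega) (by omega)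
    have g3 := h4 k (c - 1) (by omega) (by omega)
    rw [sub_add_cancel] at g3
    have g4 := hosc c hc hc'
    omega
  · rintro ⟨R, hR, rfl⟩
    refine ⟨fun k => ?_, fun k k' hk => ?_⟩
    · refine pathOf_mem_latticePaths (R k) (p.s k) rfl (hst k) (hR.start k) ?_ ?_
      · rw [hst]; exact hR.finish k
      · rw [hst]; exact hR.steps k
    · have hlt : k < k' := Fin.lt_def.2 (by omega)
      have hs := p.s_lt hlt
      have ht := p.t_lt hlt
      rw [toPaths, toPaths, osculating_pathOf_iff hs (by rw [hst, hst]; exact ht), hst]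
      intro c hc hc' he
      have g1 := hR.osc k k' hk c hc hc'
      have g2 := hR.steps k c (by omega) (by omega)
      have g3 := hR.steps k (c - 1) (by omega) (by omega)
      rw [sub_add_cancel] at g3
      refine ⟨by omega, by omega, fun h => ?_, fun h => ?_⟩
      · have g4 := hR.osc k k' hk (c - 1) (by omega) (by omega)
        have g5 := hR.steps k' (c - 1) (by omega) (by omega)
        rw [sub_add_cancel] at g4 g5
        omega
      · have g4 := hR.osc k k' hk (c + 1) (by omega) (by omega)
        have g5 := hR.steps k' c (by omega) (by omega)
        rw [add_sub_cancel_right] at g4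
        omega

/-- The height function of a tuple of paths: `(i, j)` is mapped to the number of paths that have
a point weakly above and weakly to the left of `(i, j)`. -/
noncomputable def height {r : ℕ} (P : Fin r → List (ℤ × ℤ)) (i j : ℤ) : ℕ :=
  open Classical in (Finset.univ.filter fun k => ∃ z ∈ P k, z.1 ≤ i ∧ z.2 ≤ j).card

/-- The functions that are the height function of a tuple of osculating paths with boundary
points `α` and `β`. Their increments are the edge occupations of a configuration of the six-vertex
model, and monotonicity with unit steps takes the place of the local conservation law. -/
structure IsHeight (a b : ℕ) (α β : Finset ℕ) (H : ℤ → ℤ → ℕ) : Prop where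
  le_right : ∀ i j, H i j ≤ H i (j + 1)
  right_le : ∀ i j, H i (j + 1) ≤ H i j + 1
  le_down : ∀ i j, H i j ≤ H (i + 1) j
  down_le : ∀ i j, H (i + 1) j ≤ H i j + 1
  top : ∀ i j, i ≤ 0 → H i j = 0
  left : ∀ i j, j ≤ 0 → H i j = 0
  bottom : ∀ i j, (a : ℤ) ≤ i → H i j = countLE β j
  right : ∀ i j, (b : ℤ) ≤ j → H i j = countLE α i

theorem IsHeight.mono {α β : Finset ℕ} {H : ℤ → ℤ → ℕ} (hH : IsHeight a b α β H)
    {i i' j j' : ℤ} (hi : i ≤ i') (hj : j ≤ j') : H i j ≤ H i' j' := by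
  have h1 : H i j ≤ H i' j := by
    induction i', hi using Int.leInduction with
    | base => exact le_rfl
    | succ n hn ih => exact ih.trans (hH.le_down n j)
  have h2 : H i' j ≤ H i' j' := by
    induction j', hj using Int.leInduction with
    | base => exact le_rfl
    | succ n hn ih => exact ih.trans (hH.le_right i' n)
  exact h1.trans h2

/-- The points at which a path tuple with height function `H` does not have exactly one path. -/
noncomputable def toggles (a b : ℕ) (H : ℤ → ℤ → ℕ) : Finset (ℤ × ℤ) :=
  (rect a b).filter fun z => H z.1 z.2 ≠ H (z.1 - 1) (z.2 - 1) + 1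

section tuple

variable {p : BP a b} {R : Fin p.r → ℤ → ℤ}

theorem exists_mem_toPaths_iff (k : Fin p.r) (i j : ℤ) :
    (∃ z ∈ toPaths p R k, z.1 ≤ i ∧ z.2 ≤ j) ↔ Covers (p.s k) (p.t k) (R k) i j := by
  constructor
  · rintro ⟨⟨x, y⟩, hz, h1, h2⟩
    rw [mem_toPaths] at hz
    obtain ⟨g1, g2, g3⟩ := hz
    exact ⟨y - x, g1, g2, by rw [g3]; exact h1, by rw [g3]; simpa using h2⟩
  · rintro ⟨c, h1, h2, h3, h4⟩
    refine ⟨(R k c, R k c + c), ?_, h3, h4⟩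
    rw [mem_toPaths]
    simp only [add_sub_cancel_left]
    exact ⟨h1, h2, trivial⟩

namespace IsOscTuple

/-- Every point of the path `k + 1` has a point of the path `k` weakly above and strictly to the
left of it. In `covers_up` it is strictly above and weakly to the left. -/
theorem covers_left (hR : IsOscTuple p R) {k k' : Fin p.r} (hk : (k' : ℕ) = k + 1) {i j : ℤ}
    (h : Covers (p.s k') (p.t k') (R k') i (j + 1)) : Covers (p.s k) (p.t k) (R k) i j := by
  obtain ⟨c, h1, h2, h3, h4⟩ := h
  have hlt : k < k' := Fin.lt_def.2 (by omega)
  have hs := p.s_lt hlt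
  have ht := p.t_lt hlt
  have := hR.osc k k' hk c h1 h2
  exact ⟨c - 1, by omega, by omega, by omega, by omega⟩

theorem covers_up (hR : IsOscTuple p R) {k k' : Fin p.r} (hk : (k' : ℕ) = k + 1) {i j : ℤ}
    (h : Covers (p.s k') (p.t k') (R k') (i + 1) j) : Covers (p.s k) (p.t k) (R k) i j := by
  obtain ⟨c, h1, h2, h3, h4⟩ := h
  have hlt : k < k' := Fin.lt_def.2 (by omega)
  have hs := p.s_lt hlt
  have ht := p.t_lt hlt
  have := hR.osc k k' hk c h1 h2
  exact ⟨c + 1, by omega, by omega, by omega, by omega⟩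

theorem covers_anti (hR : IsOscTuple p R) (i j : ℤ) {k k' : Fin p.r} (hk : k ≤ k') :
    Covers (p.s k') (p.t k') (R k') i j → Covers (p.s k) (p.t k) (R k) i j := by
  obtain ⟨k, hk0⟩ := k
  obtain ⟨k', hk1⟩ := k'
  rw [Fin.mk_le_mk] at hk
  induction k', hk using Nat.le_induction with
  | base => exact id
  | succ n hn ih =>
    intro h
    exact ih (by omega) (hR.covers_left (k := ⟨n, by omega⟩) rfl (h.mono le_rfl (by omega)))

theorem covers_iff_lt_height (hR : IsOscTuple p R) (k : Fin p.r) (i j : ℤ) :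
    Covers (p.s k) (p.t k) (R k) i j ↔ (k : ℕ) < height (toPaths p R) i j := by
  classical
  have h := iff_lt_card_filter (fun k => Covers (p.s k) (p.t k) (R k) i j)
    (fun k k' hk => hR.covers_anti i j hk) k
  rw [h, height]
  simp only [exists_mem_toPaths_iff]

theorem covers_imp (hR : IsOscTuple p R) {k : Fin p.r} {i j : ℤ}
    (h : Covers (p.s k) (p.t k) (R k) i j) : (p.βAt k : ℤ) ≤ j ∧ (p.αAt k : ℤ) ≤ i := by
  obtain ⟨c, h1, h2, h3, h4⟩ := h
  have g1 := (hR.steps k).anti le_rfl h1 h2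
  have g2 := (hR.steps k).anti h1 h2 le_rfl
  rw [hR.start k] at g1
  rw [hR.finish k] at g2
  unfold BP.s BP.t at *
  omega

theorem lt_height_imp (hR : IsOscTuple p R) {k k' : Fin p.r} {i j i' j' : ℤ}
    (h : Covers (p.s k) (p.t k) (R k) i j → Covers (p.s k') (p.t k') (R k') i' j') :
    (k : ℕ) < height (toPaths p R) i j → (k' : ℕ) < height (toPaths p R) i' j' := by
  rwa [← hR.covers_iff_lt_height, ← hR.covers_iff_lt_height]

theorem height_le_r (P : Fin p.r → List (ℤ × ℤ)) (i j : ℤ) : height P i j ≤ p.r := by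
  classical
  exact (Finset.card_filter_le _ _).trans (by simp)

/-- To compare values of a height function with natural numbers it suffices to look at indices of
paths. -/
theorem height_le_of {P : Fin p.r → List (ℤ × ℤ)} {i j : ℤ} {m : ℕ}
    (h : ∀ k : Fin p.r, m = k → (k : ℕ) < height P i j → False) : height P i j ≤ m := by
  by_contra hlt
  have := height_le_r P i j
  exact h ⟨m, by omega⟩ rfl (by simpa using hlt)

theorem isHeight (hR : IsOscTuple p R) : IsHeight a b p.α p.β (height (toPaths p R)) where
  le_right i j := height_le_of fun k hk h => by
    have := hR.lt_height_imp (i' := i) (j' := j + 1) (fun h => h.mono le_rfl (by omega)) h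
    omega
  le_down i j := height_le_of fun k hk h => by
    have := hR.lt_height_imp (i' := i + 1) (j' := j) (fun h => h.mono (by omega) le_rfl) h
    omega
  right_le i j := height_le_of fun k hk h => by
    have hk' : height (toPaths p R) i j < p.r := by omega
    have := hR.lt_height_imp (i' := i) (j' := j) (k' := ⟨height (toPaths p R) i j, hk'⟩)
      (fun h => hR.covers_left (by simp only; omega) h) h
    simp at this
  down_le i j := height_le_of fun k hk h => by
    have hk' : height (toPaths p R) i j < p.r := by omega
    have := hR.lt_height_imp (i' := i) (j' := j) (k' := ⟨height (toPaths p R) i j, hk'⟩)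
      (fun h => hR.covers_up (by simp only; omega) h) h
    simp at this
  top i j hi := by
    rw [← Nat.le_zero]
    refine height_le_of fun k _ h => ?_
    have := hR.covers_imp ((hR.covers_iff_lt_height k i j).2 h)
    have := p.one_le_αAt k
    omega
  left i j hj := by
    rw [← Nat.le_zero]
    refine height_le_of fun k _ h => ?_
    have := hR.covers_imp ((hR.covers_iff_lt_height k i j).2 h)
    have := p.one_le_βAt k
    omega
  bottom i j hi := by
    apply le_antisymm
    · refine height_le_of fun k hk h => ?_
      have := (hR.covers_imp ((hR.covers_iff_lt_height k i j).2 h)).1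
      rw [p.βAt_le_iff] at this
      omega
    · by_contra hlt
      rw [not_le] at hlt
      have hle : countLE p.β j ≤ p.r := by
        rw [BP.r, p.card_eq]
        exact Finset.card_filter_le _ _
      let k : Fin p.r := ⟨height (toPaths p R) i j, by omega⟩
      have hk := (p.βAt_le_iff k j).2 hlt
      have : Covers (p.s k) (p.t k) (R k) i j :=
        ⟨p.s k, le_rfl, p.s_le_t k, by rw [hR.start]; exact hi, by
          rw [hR.start]; unfold BP.s; omega⟩
      rw [hR.covers_iff_lt_height] at this
      simp [k] at this
  right i j hj := by
    apply le_antisymm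
    · refine height_le_of fun k hk h => ?_
      have := (hR.covers_imp ((hR.covers_iff_lt_height k i j).2 h)).2
      rw [p.αAt_le_iff] at this
      omega
    · by_contra hlt
      rw [not_le] at hlt
      have hle : countLE p.α i ≤ p.r := Finset.card_filter_le _ _
      let k : Fin p.r := ⟨height (toPaths p R) i j, by omega⟩
      have hk := (p.αAt_le_iff k i).2 hlt
      have : Covers (p.s k) (p.t k) (R k) i j :=
        ⟨p.t k, p.s_le_t k, le_rfl, by rw [hR.finish]; exact hk, by
          rw [hR.finish]; unfold BP.t; omega⟩
      rw [hR.covers_iff_lt_height] at this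
      simp [k] at this

theorem mem_toPaths_iff_height (hR : IsOscTuple p R) {k : Fin p.r} {i j : ℤ} (hi : i ≤ a)
    (hj : j ≤ b) : (i, j) ∈ toPaths p R k ↔
      height (toPaths p R) (i - 1) (j - 1) ≤ k ∧ (k : ℕ) < height (toPaths p R) i j := by
  rw [mem_toPaths, ← hR.covers_iff_lt_height, ← not_lt (a := (k : ℕ)), ← hR.covers_iff_lt_height]
  constructor
  · rintro ⟨h1, h2, h3⟩
    exact ((hR.steps k).row_eq_iff h1 h2).1 h3 |>.symm
  · intro h
    have := hR.covers_imp h.2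
    have h1 : p.s k ≤ j - i := by unfold BP.s; omega
    have h2 : j - i ≤ p.t k := by unfold BP.t; omega
    exact ⟨h1, h2, ((hR.steps k).row_eq_iff h1 h2).2 h.symm⟩

theorem vacOsc_eq_toggles (hR : IsOscTuple p R) :
    vacOsc a b (toPaths p R) = toggles a b (height (toPaths p R)) := by
  rw [vacOsc, vacancies, osculations, toggles, ← Finset.filter_or]
  apply Finset.filter_congr
  rintro ⟨i, j⟩ hz
  simp only [rect, Finset.mem_product, Finset.mem_Icc] at hz
  simp only [hR.mem_toPaths_iff_height hz.1.2 hz.2.2]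
  have hr := height_le_r (toPaths p R) i j
  have hm := hR.isHeight.mono (i := i - 1) (j := j - 1) (i' := i) (j' := j) (by omega) (by omega)
  generalize height (toPaths p R) (i - 1) (j - 1) = u at *
  generalize height (toPaths p R) i j = v at *
  constructor
  · rintro (h | ⟨k, k', hk, h1, h2⟩)
    · intro hv
      exact h ⟨u, by omega⟩ ⟨le_rfl, by simp only; omega⟩
    · have : (k : ℕ) ≠ k' := fun h => hk (Fin.ext h)
      omega
  · intro h
    rcases Nat.lt_or_ge u v with huv | huv
    · right
      exact ⟨⟨u, by omega⟩, ⟨u + 1, by omega⟩, by simp, ⟨le_rfl, huv⟩, by simp, by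
        simp only; omega⟩
    · left
      intro k hk
      omega

end IsOscTuple
end tuple

theorem height_injOn (p : BP a b) : Set.InjOn height (OP p) := by
  intro P hP P' hP' he
  rw [mem_OP_iff] at hP hP'
  obtain ⟨R, hR, rfl⟩ := hP
  obtain ⟨R', hR', rfl⟩ := hP'
  have hcov : ∀ k i j, Covers (p.s k) (p.t k) (R k) i j ↔ Covers (p.s k) (p.t k) (R' k) i j := by
    intro k i j
    rw [hR.covers_iff_lt_height, hR'.covers_iff_lt_height, he]
  funext k
  apply List.map_congr_left
  intro m hm
  rw [List.mem_range] at hm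
  have h1 : p.s k ≤ p.s k + (m : ℤ) := by omega
  have h2 : p.s k + (m : ℤ) ≤ p.t k := by have := p.s_le_t k; omega
  have : R k (p.s k + m) = R' k (p.s k + m) := by
    generalize p.s k + (m : ℤ) = c at *
    have e : (R k c + c) - R k c = c := by ring
    have g := (hR.steps k).row_eq_iff (i := R k c) (j := R k c + c) (by omega) (by omega)
    rw [hcov, hcov, ← (hR'.steps k).row_eq_iff (by omega) (by omega), e] at g
    exact (g.1 rfl).symm
  rw [this]

/-- Every height function comes from a tuple of osculating paths: the `k`-th path is the boundary
of the region where the height function exceeds `k`. -/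
theorem IsHeight.exists_tuple {p : BP a b} {H : ℤ → ℤ → ℕ} (hH : IsHeight a b p.α p.β H) :
    ∃ R, IsOscTuple p R ∧ height (toPaths p R) = H := by
  have hβ : ∀ (k : Fin p.r) i j, (k : ℕ) < H i j → (p.βAt k : ℤ) ≤ j := by
    intro k i j h
    rw [p.βAt_le_iff, ← hH.bottom (max i a) j (le_max_right _ _)]
    exact h.trans_le (hH.mono (le_max_left _ _) le_rfl)
  have hα : ∀ (k : Fin p.r) i j, (k : ℕ) < H i j → (p.αAt k : ℤ) ≤ i := by
    intro k i j h
    rw [p.αAt_le_iff, ← hH.right i (max j b) (le_max_right _ _)]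
    exact h.trans_le (hH.mono le_rfl (le_max_left _ _))
  have hex : ∀ (k : Fin p.r) (c : ℤ), ∃ i, (k : ℕ) < H i (i + c) ∧
      H (i - 1) (i - 1 + c) ≤ k := by
    intro k c
    obtain ⟨i, h1, h2⟩ := Int.exists_least_of_bdd (P := fun i => (k : ℕ) < H i (i + c))
      ⟨0, fun i hi => by
        have := hα k _ _ hi
        omega⟩
      ⟨max a (b - c), by
        rw [hH.right _ _ (by have := le_max_right (a : ℤ) (b - c); omega),
          countLE_top p.α_sub (le_max_left _ _)]
        exact k.2⟩
    refine ⟨i, h1, ?_⟩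
    by_contra h
    have := h2 (i - 1) (not_le.1 h)
    omega
  choose R hR1 hR2 using hex
  have huniq : ∀ (k : Fin p.r) (c i : ℤ), (k : ℕ) < H i (i + c) ↔ R k c ≤ i := by
    intro k c i
    constructor
    · intro h
      by_contra hlt
      have := hH.mono (i := i) (i' := R k c - 1) (j := i + c) (j' := R k c - 1 + c)
        (by omega) (by omega)
      have := hR2 k c
      omega
    · intro h
      exact (hR1 k c).trans_le (hH.mono h (by omega))
  have hA : ∀ (k : Fin p.r) (i j : ℤ), (k : ℕ) < H i j ↔ R k (j - i) ≤ i := by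
    intro k i j
    have := huniq k (j - i) i
    rwa [add_sub_cancel] at this
  have hstep : ∀ (k : Fin p.r) c, R k (c + 1) = R k c ∨ R k (c + 1) = R k c - 1 := by
    intro k c
    have h1 : R k (c + 1) ≤ R k c := by
      rw [← huniq]
      exact (hR1 k c).trans_le (hH.mono le_rfl (by omega))
    have h2 : R k c ≤ R k (c + 1) + 1 := by
      rw [← huniq]
      exact (hR1 k (c + 1)).trans_le (hH.mono (by omega) (by omega))
    omega
  have hT : IsOscTuple p R := by
    refine ⟨fun k => ?_, fun k => ?_, fun k c _ _ => hstep k c, fun k k' hk c h1 h2 => ?_⟩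
    · apply le_antisymm
      · rw [← huniq, hH.bottom _ _ le_rfl, ← p.βAt_le_iff, BP.s]
        omega
      · by_contra hlt
        have h := hβ k (R k (p.s k)) _ (hR1 k (p.s k))
        unfold BP.s at *
        omega
    · apply le_antisymm
      · rw [← huniq, hH.right _ _ (by unfold BP.t; omega), ← p.αAt_le_iff]
      · exact hα k (R k (p.t k)) _ (hR1 k (p.t k))
    · constructor
      · rw [← huniq]
        have h3 := hR1 k' c
        have h4 := hH.right_le (R k' c) (R k' c + (c - 1))
        have e : R k' c + (c - 1) + 1 = R k' c + c := by ring
        rw [e] at h4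
        omega
      · have h3 := hR1 k' c
        have h4 := hH.down_le (R k' c - 1) (R k' c + c)
        rw [sub_add_cancel] at h4
        have h5 : R k (c + 1) ≤ R k' c - 1 := by
          rw [← huniq]
          have e : R k' c - 1 + (c + 1) = R k' c + c := by ring
          rw [e]
          omega
        omega
  refine ⟨R, hT, ?_⟩
  have hcov : ∀ (k : Fin p.r) i j, Covers (p.s k) (p.t k) (R k) i j ↔ (k : ℕ) < H i j := by
    intro k i j
    constructor
    · rintro ⟨c, h1, h2, h3, h4⟩
      exact (hR1 k c).trans_le (hH.mono h3 h4)
    · intro h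
      have hb := hβ k i j h
      have ha := hα k i j h
      rcases lt_or_ge (j - i) (p.s k) with h1 | h1
      · refine ⟨p.s k, le_rfl, p.s_le_t k, ?_, ?_⟩ <;> rw [hT.start] <;> unfold BP.s at * <;> omega
      rcases lt_or_ge (p.t k) (j - i) with h2 | h2
      · refine ⟨p.t k, p.s_le_t k, le_rfl, ?_, ?_⟩ <;> rw [hT.finish] <;> unfold BP.t at * <;> omega
      · rw [(hT.steps k).covers_iff h1 h2]
        exact (hA k i j).1 h
  funext i j
  have h1 : ∀ k : Fin p.r, (k : ℕ) < height (toPaths p R) i j ↔ (k : ℕ) < H i j := fun k => by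
    rw [← hT.covers_iff_lt_height, hcov]
  have h2 : height (toPaths p R) i j ≤ p.r := IsOscTuple.height_le_r _ _ _
  have h3 : H i j ≤ p.r := by
    refine (hH.mono (le_max_left i a) le_rfl).trans ?_
    rw [hH.bottom _ _ (le_max_right _ _), BP.r, p.card_eq]
    exact Finset.card_filter_le _ _
  by_contra hne
  rcases Nat.lt_or_gt_of_ne hne with h | h
  · have := (h1 ⟨height (toPaths p R) i j, by omega⟩).2 h
    simp at this
  · have := (h1 ⟨H i j, by omega⟩).1 h
    simp at this

/-- The height functions with `l` points of the rectangle that do not lie on exactly one path. -/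
def heights (a b : ℕ) (α β : Finset ℕ) (l : ℕ) : Set (ℤ → ℤ → ℕ) :=
  {H | IsHeight a b α β H ∧ (toggles a b H).card = l}

theorem height_bijOn (p : BP a b) (l : ℕ) :
    Set.BijOn height (OPl p l) (heights a b p.α p.β l) := by
  refine ⟨?_, (height_injOn p).mono fun P hP => hP.1, ?_⟩
  · rintro P ⟨hP, hl⟩
    obtain ⟨R, hR, rfl⟩ := (mem_OP_iff p P).1 hP
    exact ⟨hR.isHeight, by rw [← hR.vacOsc_eq_toggles, hl]⟩
  · rintro H ⟨hH, hl⟩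
    obtain ⟨R, hR, rfl⟩ := hH.exists_tuple
    exact ⟨toPaths p R, ⟨(mem_OP_iff p _).2 ⟨R, hR, rfl⟩, by rw [hR.vacOsc_eq_toggles, hl]⟩, rfl⟩

end OscPaths

namespace OscPaths

/-! ### Young diagrams in terms of their diagonals -/

/-- The number of squares of content `c` in a Young diagram. -/
def diag (μ : YoungDiagram) (c : ℤ) : ℕ :=
  (μ.cells.filter fun z => (z.2 : ℤ) - z.1 = c).card

/-- The `m`-th square of content `c`, counted from `0` along the diagonal. -/
def square (c : ℤ) (m : ℕ) : ℕ × ℕ := (m + (-c).toNat, m + c.toNat)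

theorem square_content (c : ℤ) (m : ℕ) : ((square c m).2 : ℤ) - (square c m).1 = c := by
  simp only [square]; omega

theorem square_min (c : ℤ) (m : ℕ) : min (square c m).1 (square c m).2 = m := by
  simp only [square]; omega

theorem square_eq (z : ℕ × ℕ) : square ((z.2 : ℤ) - z.1) (min z.1 z.2) = z := by
  ext <;> simp only [square] <;> omega

/-- The squares of a given content in a Young diagram are an initial segment of their diagonal. -/
theorem square_mem_iff (μ : YoungDiagram) (c : ℤ) (m : ℕ) : square c m ∈ μ ↔ m < diag μ c := by
  have hanti : ∀ m m', m ≤ m' → square c m' ∈ μ → square c m ∈ μ := fun m m' h hm' =>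
    μ.isLowerSet (by simp only [square, Prod.mk_le_mk]; omega) hm'
  have hinj : Function.Injective (square c) := fun m m' h => by
    simp only [square, Prod.mk.injEq] at h
    omega
  constructor
  · intro h
    have h1 : (Finset.range (m + 1)).image (square c) ⊆
        μ.cells.filter fun z => (z.2 : ℤ) - z.1 = c := by
      intro z hz
      obtain ⟨m', hm', rfl⟩ := Finset.mem_image.1 hz
      rw [Finset.mem_range] at hm'
      exact Finset.mem_filter.2 ⟨hanti m' m (by omega) h, square_content c m'⟩
    have h2 := Finset.card_le_card h1
    rw [Finset.card_image_of_injective _ hinj, Finset.card_range] at h2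
    exact h2
  · intro h
    by_contra hm
    have h1 : (μ.cells.filter fun z => (z.2 : ℤ) - z.1 = c) ⊆
        (Finset.range m).image (square c) := by
      intro z hz
      rw [Finset.mem_filter] at hz
      have hz' := square_eq z
      rw [hz.2] at hz'
      refine Finset.mem_image.2 ⟨min z.1 z.2, ?_, hz'⟩
      rw [Finset.mem_range]
      by_contra hle
      apply hm
      refine hanti m _ (not_lt.1 hle) ?_
      rw [hz']
      exact hz.1
    have h2 := Finset.card_le_card h1
    rw [Finset.card_image_of_injective _ hinj, Finset.card_range] at h2
    unfold diag at h
    omega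

theorem mem_iff_min_lt_diag (μ : YoungDiagram) (x y : ℕ) :
    (x, y) ∈ μ ↔ min x y < diag μ ((y : ℤ) - x) := by
  rw [← square_mem_iff, square_eq (x, y)]

theorem diag_injective : Function.Injective diag := by
  intro μ ν h
  ext ⟨x, y⟩
  rw [YoungDiagram.mem_cells, YoungDiagram.mem_cells, mem_iff_min_lt_diag, mem_iff_min_lt_diag, h]

theorem diag_bot : diag ⊥ = 0 := by
  funext c
  simp [diag]

/-- The relation between the numbers `p` and `q` of squares of contents `c - 1` and `c` in a Young
diagram. -/
def Compat (c : ℤ) (p q : ℕ) : Prop :=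
  (1 ≤ c → q ≤ p ∧ p ≤ q + 1) ∧ (c ≤ 0 → p ≤ q ∧ q ≤ p + 1)

theorem compat_diag (μ : YoungDiagram) (c : ℤ) : Compat c (diag μ (c - 1)) (diag μ c) := by
  have key : ∀ d d' m m', square d' m' ≤ square d m → m < diag μ d → m' < diag μ d' := by
    intro d d' m m' h
    rw [← square_mem_iff, ← square_mem_iff]
    exact fun hm => μ.isLowerSet h hm
  have to_le : ∀ u v : ℕ, (∀ m, m < u → m < v) → u ≤ v := fun u v h => by
    by_contra hlt
    exact lt_irrefl _ (h v (not_le.1 hlt))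
  have to_le' : ∀ u v : ℕ, (∀ m, m + 1 < u → m < v) → u ≤ v + 1 := fun u v h => by
    by_contra hlt
    exact lt_irrefl _ (h v (not_le.1 hlt))
  refine ⟨fun hc => ⟨to_le _ _ fun m => key _ _ _ _ ?_, to_le' _ _ fun m => key _ _ _ _ ?_⟩,
    fun hc => ⟨to_le _ _ fun m => key _ _ _ _ ?_, to_le' _ _ fun m => key _ _ _ _ ?_⟩⟩ <;>
  · simp only [square, Prod.mk_le_mk]; omega

/-- A finitely supported function whose neighbouring values are compatible is the sequence of the
diagonal sizes of a Young diagram. -/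
theorem exists_diag_eq {f : ℤ → ℕ} (hf : ∀ c, Compat c (f (c - 1)) (f c)) {N : ℕ}
    (hN : ∀ c : ℤ, (N : ℤ) ≤ |c| → f c = 0) : ∃ μ, diag μ = f := by
  have h1 : ∀ x y : ℕ, min x (y + 1) < f (((y + 1 : ℕ) : ℤ) - x) → min x y < f ((y : ℤ) - x) := by
    intro x y h
    have := hf (((y + 1 : ℕ) : ℤ) - x)
    have e : ((y + 1 : ℕ) : ℤ) - x - 1 = y - x := by push_cast; ring
    rw [e] at this
    obtain ⟨g1, g2⟩ := this
    omega
  have h2 : ∀ x y : ℕ, min (x + 1) y < f ((y : ℤ) - ((x + 1 : ℕ) : ℤ)) →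
      min x y < f ((y : ℤ) - x) := by
    intro x y h
    have := hf ((y : ℤ) - x)
    have e : (y : ℤ) - ((x + 1 : ℕ) : ℤ) = y - x - 1 := by push_cast; ring
    rw [e] at h
    obtain ⟨g1, g2⟩ := this
    omega
  have h3 : ∀ x y y' : ℕ, y ≤ y' → min x y' < f ((y' : ℤ) - x) → min x y < f ((y : ℤ) - x) := by
    intro x y y' hy h
    induction y', hy using Nat.le_induction with
    | base => exact h
    | succ n hn ih => exact ih (h1 _ _ h)
  have h4 : ∀ x x' y : ℕ, x ≤ x' → min x' y < f ((y : ℤ) - x') → min x y < f ((y : ℤ) - x) := by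
    intro x x' y hx h
    induction x', hx using Nat.le_induction with
    | base => exact h
    | succ n hn ih => exact ih (h2 _ _ h)
  have h5 : ∀ x y : ℕ, min x y < f ((y : ℤ) - x) → x < N ∧ y < N := by
    intro x y h
    constructor
    · by_contra hx
      have := h3 x 0 y (Nat.zero_le _) h
      rw [hN _ (by rw [abs_of_nonpos] <;> push_cast <;> omega)] at this
      omega
    · by_contra hy
      have := h4 0 x y (Nat.zero_le _) h
      rw [hN _ (by rw [abs_of_nonneg] <;> push_cast <;> omega)] at this
      omega
  let μ : YoungDiagram :=
    { cells := (Finset.range N ×ˢ Finset.range N).filter fun z => min z.1 z.2 < f ((z.2 : ℤ) - z.1)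
      isLowerSet := by
        rintro ⟨x', y'⟩ ⟨x, y⟩ hle hmem
        obtain ⟨hx, hy⟩ := Prod.mk_le_mk.1 hle
        simp only [Finset.coe_filter, Finset.mem_product, Finset.mem_range, Set.mem_ofPred_eq]
          at hmem ⊢
        exact ⟨by omega, h4 _ _ _ hx (h3 _ _ _ hy hmem.2)⟩ }
  have hμ : ∀ x y : ℕ, (x, y) ∈ μ ↔ min x y < f ((y : ℤ) - x) := by
    intro x y
    rw [← YoungDiagram.mem_cells]
    simp only [μ, Finset.mem_filter, Finset.mem_product, Finset.mem_range]
    exact ⟨fun h => h.2, fun h => ⟨h5 x y h, h⟩⟩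
  refine ⟨μ, funext fun c => ?_⟩
  have h6 : ∀ m, m < diag μ c ↔ m < f c := by
    intro m
    rw [← square_mem_iff]
    have := hμ (square c m).1 (square c m).2
    rwa [square_min, square_content] at this
  have h7 := h6 (diag μ c)
  have h8 := h6 (f c)
  omega

theorem diag_insert {μ ν : YoungDiagram} {z : ℕ × ℕ} (hz : z ∉ μ.cells)
    (h : ν.cells = insert z μ.cells) (c : ℤ) :
    diag ν c = diag μ c + if (z.2 : ℤ) - z.1 = c then 1 else 0 := by
  rw [diag, h, Finset.filter_insert]
  split_ifs with hc
  · rw [Finset.card_insert_of_notMem (by simp [hz]), diag]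
  · rfl

theorem diagDiff_insert {μ ν : YoungDiagram} {z : ℕ × ℕ} (hz : z ∉ μ.cells)
    (h : ν.cells = insert z μ.cells) : diagDiff μ ν = (z.2 : ℤ) - z.1 := by
  have : symmDiff μ.cells ν.cells = {z} := by
    ext w
    rw [Finset.mem_symmDiff, h, Finset.mem_insert, Finset.mem_singleton]
    by_cases hw : w = z
    · subst hw; simp [hz]
    · simp [hw]
  rw [diagDiff, this, Finset.sum_singleton]

theorem diagDiff_comm (μ ν : YoungDiagram) : diagDiff μ ν = diagDiff ν μ := by
  rw [diagDiff, symmDiff_comm, diagDiff]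

theorem DiffBySquare.symm {μ ν : YoungDiagram} (h : DiffBySquare μ ν) : DiffBySquare ν μ := by
  obtain ⟨z, hz⟩ := h
  exact ⟨z, hz.symm⟩

theorem DiffBySquare.diag_eq {μ ν : YoungDiagram} (h : DiffBySquare μ ν) {c : ℤ}
    (hc : c ≠ diagDiff μ ν) : diag ν c = diag μ c := by
  obtain ⟨z, ⟨hz, h⟩ | ⟨hz, h⟩⟩ := h
  · rw [diagDiff_comm, diagDiff_insert hz h] at hc
    rw [diag_insert hz h, if_neg hc.symm, add_zero]
  · rw [diagDiff_insert hz h] at hc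
    rw [diag_insert hz h, if_neg hc.symm, add_zero]

theorem DiffBySquare.diag_cases {μ ν : YoungDiagram} (h : DiffBySquare μ ν) :
    diag ν (diagDiff μ ν) = diag μ (diagDiff μ ν) + 1 ∨
      diag μ (diagDiff μ ν) = diag ν (diagDiff μ ν) + 1 := by
  obtain ⟨z, ⟨hz, h⟩ | ⟨hz, h⟩⟩ := h
  · rw [diagDiff_comm, diagDiff_insert hz h, diag_insert hz h, if_pos rfl]
    omega
  · rw [diagDiff_insert hz h, diag_insert hz h, if_pos rfl]
    omega

theorem diffBySquare_of_diag_succ {μ ν : YoungDiagram} {c : ℤ} (hc : diag ν c = diag μ c + 1)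
    (h : ∀ d ≠ c, diag ν d = diag μ d) : DiffBySquare μ ν ∧ diagDiff μ ν = c := by
  have h1 : square c (diag μ c) ∉ μ.cells := by
    rw [YoungDiagram.mem_cells, square_mem_iff]
    exact lt_irrefl _
  have h2 : ν.cells = insert (square c (diag μ c)) μ.cells := by
    ext z
    rw [Finset.mem_insert, YoungDiagram.mem_cells, YoungDiagram.mem_cells]
    rw [← square_eq z, square_mem_iff, square_mem_iff]
    by_cases hz : (z.2 : ℤ) - z.1 = c
    · rw [hz, hc]
      have : square c (min z.1 z.2) = square c (diag μ c) ↔ min z.1 z.2 = diag μ c := by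
        simp only [square, Prod.mk.injEq]
        omega
      rw [this]
      omega
    · rw [h _ hz]
      constructor
      · exact Or.inr
      · rintro (he | he)
        · exfalso
          apply hz
          rw [← square_content ((z.2 : ℤ) - z.1) (min z.1 z.2), he, square_content]
        · exact he
  exact ⟨⟨_, Or.inr ⟨h1, h2⟩⟩, by rw [diagDiff_insert h1 h2, square_content]⟩

theorem diffBySquare_of_diag {μ ν : YoungDiagram} {c : ℤ}
    (hc : diag ν c = diag μ c + 1 ∨ diag μ c = diag ν c + 1)
    (h : ∀ d ≠ c, diag ν d = diag μ d) : DiffBySquare μ ν ∧ diagDiff μ ν = c := by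
  rcases hc with hc | hc
  · exact diffBySquare_of_diag_succ hc h
  · have := diffBySquare_of_diag_succ hc fun d hd => (h d hd).symm
    exact ⟨this.1.symm, by rw [diagDiff_comm, this.2]⟩

/-- The squares of a Young diagram with `n` squares lie in an `n` by `n` box. -/
theorem mem_box_of_mem {μ : YoungDiagram} {z : ℕ × ℕ} (hz : z ∈ μ.cells) :
    z ∈ Finset.range μ.card ×ˢ Finset.range μ.card := by
  obtain ⟨x, y⟩ := z
  have h1 : (Finset.range (x + 1)).image (fun i => (i, y)) ⊆ μ.cells := fun w hw => by
    obtain ⟨i, hi, rfl⟩ := Finset.mem_image.1 hw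
    rw [Finset.mem_range] at hi
    exact μ.isLowerSet (Prod.mk_le_mk.2 ⟨by omega, le_rfl⟩) hz
  have h2 : (Finset.range (y + 1)).image (fun j => (x, j)) ⊆ μ.cells := fun w hw => by
    obtain ⟨i, hi, rfl⟩ := Finset.mem_image.1 hw
    rw [Finset.mem_range] at hi
    exact μ.isLowerSet (Prod.mk_le_mk.2 ⟨le_rfl, by omega⟩) hz
  have h3 := Finset.card_le_card h1
  have h4 := Finset.card_le_card h2
  rw [Finset.card_image_of_injective _ (fun i j h => (Prod.mk.inj h).1), Finset.card_range] at h3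
  rw [Finset.card_image_of_injective _ (fun i j h => (Prod.mk.inj h).2), Finset.card_range] at h4
  simp only [Finset.mem_product, Finset.mem_range]
  exact ⟨h3, h4⟩

theorem finite_card_le (n : ℕ) : {μ : YoungDiagram | μ.card ≤ n}.Finite := by
  refine Set.Finite.of_finite_image (f := YoungDiagram.cells) ?_ fun μ _ ν _ h => by
    ext1; exact h
  refine (Finset.finite_toSet (Finset.range n ×ˢ Finset.range n).powerset).subset ?_
  rintro _ ⟨μ, hμ, rfl⟩
  rw [Finset.mem_coe, Finset.mem_powerset]
  intro z hz
  have := mem_box_of_mem hz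
  rw [Set.mem_ofPred_eq] at hμ
  simp only [Finset.mem_product, Finset.mem_range] at this ⊢
  omega

theorem OT_finite (μ : YoungDiagram) (l : ℕ) : (OT μ l).Finite := by
  refine (Set.Finite.pi' fun _ : Fin (l + 1) => finite_card_le l).subset ?_
  rintro η ⟨h0, -, hs⟩ k
  have : (η k).card ≤ k := by
    induction k using Fin.induction with
    | zero => rw [h0]; simp
    | succ k ih =>
      obtain ⟨z, ⟨hz, h⟩ | ⟨hz, h⟩⟩ := hs k
      · have h1 : (η k.castSucc).card = (η k.succ).card + 1 := by
          rw [YoungDiagram.card, h, Finset.card_insert_of_notMem hz]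
        rw [Fin.val_castSucc] at ih
        rw [Fin.val_succ]
        omega
      · have h1 : (η k.succ).card = (η k.castSucc).card + 1 := by
          rw [YoungDiagram.card, h, Finset.card_insert_of_notMem hz]
        rw [Fin.val_castSucc] at ih
        rw [Fin.val_succ]
        omega
  exact this.trans (Nat.lt_succ_iff.1 k.2)

/-! ### Transposition -/

theorem diag_transpose (μ : YoungDiagram) (c : ℤ) : diag μ.transpose c = diag μ (-c) := by
  have h1 : ∀ m, m < diag μ.transpose c ↔ m < diag μ (-c) := by
    intro m
    rw [← square_mem_iff, ← square_mem_iff, YoungDiagram.mem_transpose]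
    have : (square c m).swap = square (-c) m := by ext <;> simp [square]
    rw [this]
  have h2 := h1 (diag μ.transpose c)
  have h3 := h1 (diag μ (-c))
  omega

theorem DiffBySquare.transpose {μ ν : YoungDiagram} (h : DiffBySquare μ ν) :
    DiffBySquare μ.transpose ν.transpose ∧
      diagDiff μ.transpose ν.transpose = - diagDiff μ ν := by
  apply diffBySquare_of_diag
  · simp only [diag_transpose, neg_neg]
    exact h.diag_cases
  · intro d hd
    rw [diag_transpose, diag_transpose]
    exact h.diag_eq fun he => hd (by omega)

theorem transpose_mem_OT {μ : YoungDiagram} {l : ℕ} {η : Fin (l + 1) → YoungDiagram}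
    (h : η ∈ OT μ l) : (fun k => (η k).transpose) ∈ OT μ.transpose l := by
  refine ⟨?_, ?_, fun k => (h.2.2 k).transpose.1⟩
  · simp only [h.1]
    apply diag_injective
    funext c
    rw [diag_transpose, diag_bot]
    rfl
  · simp only [h.2.1]

theorem transpose_bijOn_OT (μ : YoungDiagram) (l : ℕ) :
    Set.BijOn (fun η k => (η k).transpose) (OT μ l) (OT μ.transpose l) := by
  refine ⟨fun η => transpose_mem_OT, fun η _ η' _ h => ?_, fun η h => ?_⟩
  · funext k
    have := congrFun h k
    simpa using congrArg YoungDiagram.transpose this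
  · refine ⟨fun k => (η k).transpose, ?_, by simp⟩
    simpa using transpose_mem_OT h

theorem asc_transpose {μ : YoungDiagram} {l : ℕ} {η : Fin (l + 1) → YoungDiagram}
    (h : η ∈ OT μ l) : asc (· > ·) (fun k => (η k).transpose) = asc (· < ·) η := by
  have h1 : ∀ k, profile (fun k => (η k).transpose) k = - profile η k := fun k =>
    (h.2.2 k).transpose.2
  simp only [asc, h1, gt_iff_lt, neg_lt_neg_iff]

end OscPaths

namespace OscPaths

/-! ### The partition attached to the boundary points -/

theorem mem_frobenius {r : ℕ} {γ δ : Fin r → ℕ} {hγ : StrictAnti γ} {hδ : StrictAnti δ}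
    (u w : ℕ) : (u, w) ∈ frobenius γ δ hγ hδ ↔
      (u ≤ w ∧ ∃ h : u < r, w ≤ u + γ ⟨u, h⟩) ∨ (w ≤ u ∧ ∃ h : w < r, u ≤ w + δ ⟨w, h⟩) := by
  rw [← YoungDiagram.mem_cells]
  simp only [frobenius, Finset.mem_biUnion, Finset.mem_univ, true_and, Finset.mem_union,
    Finset.mem_image, Finset.mem_range, Prod.mk.injEq]
  constructor
  · rintro ⟨k, ⟨m, h1, rfl, rfl⟩ | ⟨m, h1, rfl, rfl⟩⟩
    · exact Or.inl ⟨by omega, k.2, by simp only [Fin.eta]; omega⟩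
    · exact Or.inr ⟨by omega, k.2, by simp only [Fin.eta]; omega⟩
  · rintro (⟨h1, h2, h3⟩ | ⟨h1, h2, h3⟩)
    · exact ⟨⟨u, h2⟩, Or.inl ⟨w - u, by omega, rfl, by simp only; omega⟩⟩
    · exact ⟨⟨w, h2⟩, Or.inr ⟨u - w, by omega, by simp only; omega, rfl⟩⟩

theorem mem_complement (a b : ℕ) (μ : YoungDiagram) (x y : ℕ) :
    (x, y) ∈ complement a b μ ↔ x < a ∧ y < b ∧ (a - 1 - x, b - 1 - y) ∉ μ := by
  rw [← YoungDiagram.mem_cells]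
  simp only [complement, Finset.mem_filter, Finset.mem_product, Finset.mem_range,
    YoungDiagram.mem_iff_lt_rowLen]
  omega

variable {a b : ℕ}

theorem BP.countLE_β_le (p : BP a b) (x : ℤ) : countLE p.β x ≤ p.r := by
  rw [BP.r, p.card_eq]
  exact Finset.card_filter_le _ _

theorem BP.countLE_α_le (p : BP a b) (x : ℤ) : countLE p.α x ≤ p.r :=
  Finset.card_filter_le _ _

theorem BP.mem_toPartition (p : BP a b) (x y : ℕ) :
    (x, y) ∈ p.toPartition ↔ x < a ∧ y < b ∧
      ((a : ℤ) - x ≤ (b : ℤ) - y → (countLE p.β (a + y - x) : ℤ) < (a : ℤ) - x) ∧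
      ((b : ℤ) - y ≤ (a : ℤ) - x → (countLE p.α (b + x - y) : ℤ) < (b : ℤ) - y) := by
  rw [BP.toPartition, mem_complement]
  refine and_congr_right fun hx => and_congr_right fun hy => ?_
  have h1 : (∃ h : a - 1 - x < p.r, b - 1 - y ≤ a - 1 - x + (b - p.βAt ⟨a - 1 - x, h⟩)) ↔
      (a - 1 - x : ℕ) < countLE p.β (a + y - x) := by
    constructor
    · rintro ⟨h, h'⟩
      refine (p.βAt_le_iff ⟨a - 1 - x, h⟩ _).1 ?_
      have := p.βAt_le ⟨a - 1 - x, h⟩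
      omega
    · intro h
      have hr := h.trans_le (p.countLE_β_le _)
      have := (p.βAt_le_iff ⟨a - 1 - x, hr⟩ _).2 h
      exact ⟨hr, by omega⟩
  have h2 : (∃ h : b - 1 - y < p.r, a - 1 - x ≤ b - 1 - y + (a - p.αAt ⟨b - 1 - y, h⟩)) ↔
      (b - 1 - y : ℕ) < countLE p.α (b + x - y) := by
    constructor
    · rintro ⟨h, h'⟩
      refine (p.αAt_le_iff ⟨b - 1 - y, h⟩ _).1 ?_
      have := p.αAt_le ⟨b - 1 - y, h⟩
      omega
    · intro h
      have hr := h.trans_le (p.countLE_α_le _)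
      have := (p.αAt_le_iff ⟨b - 1 - y, hr⟩ _).2 h
      exact ⟨hr, by omega⟩
  refine (not_congr ((mem_frobenius _ _).trans
    (or_congr (and_congr_right fun _ => h1) (and_congr_right fun _ => h2)))).trans ?_
  omega

/-- The boundary points obtained by interchanging rows and columns. -/
def BP.swap (p : BP a b) : BP b a := ⟨p.β, p.α, p.β_sub, p.α_sub, p.card_eq.symm⟩

theorem BP.toPartition_swap (p : BP a b) : p.swap.toPartition = p.toPartition.transpose := by
  ext ⟨x, y⟩
  rw [YoungDiagram.mem_cells, YoungDiagram.mem_cells, YoungDiagram.mem_transpose, Prod.swap_prod_mk,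
    BP.mem_toPartition, BP.mem_toPartition]
  simp only [BP.swap]
  tauto

theorem countLE_le {s : Finset ℕ} {n : ℕ} (hs : s ⊆ Finset.Icc 1 n) {x : ℤ} (hx : 0 ≤ x) :
    (countLE s x : ℤ) ≤ x := by
  have h1 : s.filter (fun m : ℕ => (m : ℤ) ≤ x) ⊆ Finset.Icc 1 x.toNat := by
    intro m hm
    rw [Finset.mem_filter] at hm
    have := Finset.mem_Icc.1 (hs hm.1)
    rw [Finset.mem_Icc]
    omega
  have h2 := Finset.card_le_card h1
  rw [Nat.card_Icc] at h2
  unfold countLE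
  omega

theorem BP.le_of_α_eq (p : BP a b) (hα : p.α = Finset.Icc 1 a) : a ≤ b := by
  have h1 := p.card_eq
  have h2 := Finset.card_le_card p.β_sub
  rw [hα] at h1
  simp only [Nat.card_Icc] at h1 h2
  omega

/-- The diagonal sizes of the partition of `p` are the values of `min i j - H i j` on the bottom row
`i = a`, for any height function `H` with boundary points `p`. -/
theorem BP.diag_toPartition (p : BP a b) (hα : p.α = Finset.Icc 1 a) (c : ℤ) :
    (diag p.toPartition c : ℤ) = max 0 (min (a : ℤ) (a + c)) - countLE p.β (a + c) := by
  have hab := p.le_of_α_eq hα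
  have hr : p.r = a := by rw [BP.r, hα]; simp
  have hβr := p.countLE_β_le (a + c)
  have h0 : a + c ≤ 0 → countLE p.β (a + c) = 0 := countLE_zero p.β_sub
  have h1 : 0 ≤ a + c → (countLE p.β (a + c) : ℤ) ≤ a + c := countLE_le p.β_sub
  have h2 : (b : ℤ) ≤ a + c → countLE p.β (a + c) = a := fun h => by
    rw [countLE_top p.β_sub h, ← p.card_eq]
    exact hr
  have key : ∀ m : ℕ, m < diag p.toPartition c ↔
      (m : ℤ) < max 0 (min (a : ℤ) (a + c)) - countLE p.β (a + c) := by
    intro m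
    rw [← square_mem_iff, square, BP.mem_toPartition, hα]
    have e : (a : ℤ) + (m + c.toNat : ℕ) - (m + (-c).toNat : ℕ) = a + c := by omega
    have h3 : m + c.toNat < b → (b : ℤ) - (m + c.toNat : ℕ) ≤ (a : ℤ) - (m + (-c).toNat : ℕ) →
        (countLE (Finset.Icc 1 a) ((b : ℤ) + (m + (-c).toNat : ℕ) - (m + c.toNat : ℕ)) : ℤ) =
          (b : ℤ) + (m + (-c).toNat : ℕ) - (m + c.toNat : ℕ) :=
      fun _ h => countLE_Icc a (by omega) (by omega)
    rw [e]
    omega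
  have h3 := key (diag p.toPartition c)
  have h4 := key (max 0 (min (a : ℤ) (a + c)) - countLE p.β (a + c)).toNat
  omega

/-! ### Compatible sequences of rows -/

/-- The sequences of `l` numbers from `1` to `a` that increase weakly, and increase strictly
wherever the sequence `Ω` does not ascend. -/
def rowSeqs (a : ℕ) {l : ℕ} (Ω : Fin l → ℤ) : Set (Fin l → ℤ) :=
  {t | (∀ k, 1 ≤ t k ∧ t k ≤ a) ∧ StrictMono fun k => toLex (t k, Ω k)}

theorem ncard_strictMono (N l : ℕ) :
    {s : Fin l → ℤ | (∀ k, 1 ≤ s k ∧ s k ≤ N) ∧ StrictMono s}.ncard = N.choose l := by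
  have hb : Set.BijOn (fun s : Fin l → ℤ => Finset.univ.image s)
      {s : Fin l → ℤ | (∀ k, 1 ≤ s k ∧ s k ≤ N) ∧ StrictMono s}
      ((Finset.Icc (1 : ℤ) N).powersetCard l : Set (Finset ℤ)) := by
    refine ⟨?_, ?_, ?_⟩
    · rintro s ⟨h1, h2⟩
      rw [Finset.mem_coe, Finset.mem_powersetCard]
      refine ⟨fun x hx => ?_, ?_⟩
      · obtain ⟨k, -, rfl⟩ := Finset.mem_image.1 hx
        exact Finset.mem_Icc.2 (h1 k)
      · rw [Finset.card_image_of_injective _ h2.injective]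
        simp
    · rintro s ⟨-, h⟩ s' ⟨-, h'⟩ he
      rw [← StrictMono.range_inj h h']
      have := congrArg (fun S : Finset ℤ => (S : Set ℤ)) he
      simpa using this
    · intro S hS
      rw [Finset.mem_coe, Finset.mem_powersetCard] at hS
      refine ⟨S.orderEmbOfFin hS.2, ⟨fun k => ?_, (S.orderEmbOfFin hS.2).strictMono⟩, ?_⟩
      · exact Finset.mem_Icc.1 (hS.1 (Finset.orderEmbOfFin_mem _ _ k))
      · simp
  rw [Set.ncard_congr (fun s _ => Finset.univ.image s) (fun s hs => hb.mapsTo hs)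
    (fun s s' hs hs' h => hb.injOn hs hs' h) (fun S hS => by
      obtain ⟨s, hs, h⟩ := hb.surjOn hS
      exact ⟨s, hs, h⟩), Set.ncard_coe_finset, Finset.card_powersetCard, Int.card_Icc]
  simp

/-- Adding to each entry the number of earlier ascents of `Ω` turns the compatible sequences into
the strictly increasing ones. -/
theorem ncard_rowSeqs_succ (a : ℕ) {n : ℕ} (Ω : Fin (n + 1) → ℤ) :
    (rowSeqs a Ω).ncard =
      (a + (Finset.univ.filter fun k : Fin n => Ω k.castSucc < Ω k.succ).card).choose (n + 1) := by
  set A : Fin (n + 1) → ℕ := fun k =>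
    (Finset.univ.filter fun m : Fin n => m.castSucc < k ∧ Ω m.castSucc < Ω m.succ).card with hA
  set N := (Finset.univ.filter fun k : Fin n => Ω k.castSucc < Ω k.succ).card with hN
  have hA0 : A 0 = 0 := by simp [hA]
  have hAlast : A (Fin.last n) = N := by
    simp only [hA, hN]
    congr 1
    ext m
    simp [Fin.castSucc_lt_last]
  have hAsucc : ∀ k : Fin n, A k.succ = A k.castSucc + if Ω k.castSucc < Ω k.succ then 1 else 0 := by
    intro k
    simp only [hA]
    split_ifs with h
    · rw [← Finset.card_insert_of_notMem (a := k) (by simp)]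
      congr 1
      ext m
      simp only [Finset.mem_filter, Finset.mem_univ, true_and, Finset.mem_insert, Fin.lt_def,
        Fin.val_castSucc, Fin.val_succ]
      constructor
      · rintro ⟨h1, h2⟩
        by_cases hm : m = k
        · exact Or.inl hm
        · have : (m : ℕ) ≠ k := fun h => hm (Fin.ext h)
          exact Or.inr ⟨by omega, h2⟩
      · rintro (rfl | ⟨h1, h2⟩)
        · exact ⟨by omega, h⟩
        · exact ⟨by omega, h2⟩
    · rw [add_zero]
      congr 1
      ext m
      simp only [Finset.mem_filter, Finset.mem_univ, true_and, Fin.lt_def,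
        Fin.val_castSucc, Fin.val_succ]
      constructor
      · rintro ⟨h1, h2⟩
        have : (m : ℕ) ≠ k := fun hm => h (by rwa [Fin.ext hm] at h2)
        exact ⟨by omega, h2⟩
      · rintro ⟨h1, h2⟩
        exact ⟨by omega, h2⟩
  have hAle : ∀ k, A k ≤ N := fun k => by
    refine Finset.card_le_card fun m hm => ?_
    rw [Finset.mem_filter] at hm ⊢
    exact ⟨hm.1, hm.2.2⟩
  have hstep : ∀ (t : Fin (n + 1) → ℤ) (k : Fin n),
      toLex (t k.castSucc, Ω k.castSucc) < toLex (t k.succ, Ω k.succ) ↔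
        t k.castSucc + A k.castSucc < t k.succ + A k.succ := by
    intro t k
    rw [Prod.Lex.toLex_lt_toLex, hAsucc]
    split_ifs with h <;> dsimp only <;> push_cast <;> omega
  rw [← ncard_strictMono]
  refine Set.ncard_congr (fun t _ k => t k + A k) ?_ ?_ ?_
  · rintro t ⟨h1, h2⟩
    refine ⟨fun k => ?_, Fin.strictMono_iff_lt_succ.2 fun k => ?_⟩
    · have := h1 k
      have := hAle k
      push_cast
      omega
    · exact (hstep t k).1 (Fin.strictMono_iff_lt_succ.1 h2 k)
  · intro t t' _ _ h
    funext k
    have := congrFun h k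
    simpa using this
  · rintro s ⟨h1, h2⟩
    have hmono : Monotone fun k => s k - A k := by
      rw [Fin.monotone_iff_le_succ]
      intro k
      have := Fin.strictMono_iff_lt_succ.1 h2 k
      rw [hAsucc]
      split_ifs <;> push_cast <;> omega
    refine ⟨fun k => s k - A k, ⟨fun k => ⟨?_, ?_⟩, ?_⟩, ?_⟩
    · have h3 : s 0 - A 0 ≤ s k - A k := hmono (Fin.zero_le k)
      have h4 := (h1 0).1
      rw [hA0] at h3
      dsimp only
      omega
    · have h3 : s k - A k ≤ s (Fin.last n) - A (Fin.last n) := hmono (Fin.le_last k)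
      have h4 := (h1 (Fin.last n)).2
      rw [hAlast] at h3
      push_cast at h4
      dsimp only
      omega
    · rw [Fin.strictMono_iff_lt_succ]
      intro k
      refine (hstep (fun k => s k - A k) k).2 ?_
      have := Fin.strictMono_iff_lt_succ.1 h2 k
      omega
    · funext k
      simp

theorem ncard_rowSeqs (a : ℕ) {l : ℕ} (η : Fin (l + 1) → YoungDiagram) :
    (rowSeqs a (profile η)).ncard = (a + asc (· < ·) η).choose l := by
  rcases l with _ | n
  · have : rowSeqs a (profile η) = {Fin.elim0} := by
      ext t
      simp only [rowSeqs, Set.mem_singleton_iff, eq_iff_true_of_subsingleton, iff_true]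
      exact ⟨fun k => k.elim0, fun k => k.elim0⟩
    rw [this, Set.ncard_singleton, Nat.choose_zero_right]
  · exact ncard_rowSeqs_succ a (profile η)

end OscPaths

namespace OscPaths

/-! ### Height functions and chains of partitions -/

/-- A chain of partitions, given by their diagonal sizes `n i c`, that passes in `a` rows from the
empty partition to `ν`. From row `i - 1` to row `i` squares are added or removed in the order of
increasing content; `compat_col` says that the intermediate diagrams are diagrams of partitions. -/
structure IsPartitionChain (a : ℕ) (ν : YoungDiagram) (n : ℤ → ℤ → ℕ) : Prop where
  zero : ∀ i c, i ≤ 0 → n i c = 0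
  last : ∀ i c, (a : ℤ) ≤ i → n i c = diag ν c
  compat_row : ∀ i c, Compat c (n i (c - 1)) (n i c)
  compat_col : ∀ i c, Compat c (n i (c - 1)) (n (i - 1) c)

/-- The pairs of a row and a content for which a square is added or removed. -/
def changes (n : ℤ → ℤ → ℕ) : Set (ℤ ×ₗ ℤ) :=
  {w | n (ofLex w).1 (ofLex w).2 ≠ n ((ofLex w).1 - 1) (ofLex w).2}

/-- The chains of partitions with `l` changes. -/
def chains (a : ℕ) (ν : YoungDiagram) (l : ℕ) : Set (ℤ → ℤ → ℕ) :=
  {n | IsPartitionChain a ν n ∧ (changes n).encard = l}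

theorem toLex_mem_changes {n : ℤ → ℤ → ℕ} {i c : ℤ} :
    toLex (i, c) ∈ changes n ↔ n i c ≠ n (i - 1) c := Iff.rfl

/-- The row `i`, replaced by the nearest row from `0` to `a`. -/
def clamp (a : ℕ) (i : ℤ) : ℤ := max 0 (min i a)

theorem clamp_of_mem {a : ℕ} {i : ℤ} (h0 : 0 ≤ i) (h1 : i ≤ a) : clamp a i = i := by
  unfold clamp; omega

namespace IsPartitionChain

variable {a b : ℕ} {p : BP a b} {n : ℤ → ℤ → ℕ}

theorem clamp_eq {ν : YoungDiagram} (hn : IsPartitionChain a ν n) (i c : ℤ) :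
    n (clamp a i) c = n i c := by
  rcases le_total i 0 with h | h
  · rw [hn.zero i c h, hn.zero _ c (by unfold clamp; omega)]
  rcases le_total (a : ℤ) i with h' | h'
  · rw [hn.last i c h', hn.last _ c (by unfold clamp; omega)]
  · rw [clamp_of_mem h h']

/-- Going down a column `i + c = j ≤ 0`, the diagonal sizes weakly decrease from `0`. -/
theorem eq_zero_left {ν : YoungDiagram} (hn : IsPartitionChain a ν n) {i c : ℤ} (hi : 0 ≤ i)
    (hc : i + c ≤ 0) : n i c = 0 := by
  induction i, hi using Int.leInduction generalizing c with
  | base => exact hn.zero _ _ le_rfl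
  | succ i hi ih =>
    have h1 := (hn.compat_col (i + 1) (c + 1)).2 (by omega)
    rw [add_sub_cancel_right, add_sub_cancel_right, ih (by omega)] at h1
    omega

/-- Going down a column `i + c = j ≥ b`, the diagonal sizes weakly increase, and they end at `0`
because `α = [a]` leaves no square of the final partition there. -/
theorem eq_zero_right (hα : p.α = Finset.Icc 1 a) (hn : IsPartitionChain a p.toPartition n)
    {i c : ℤ} (hi : i ≤ a) (hc : (b : ℤ) ≤ i + c) : n i c = 0 := by
  have hab := p.le_of_α_eq hα
  induction i, hi using Int.leInductionDown generalizing c with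
  | base =>
    rw [hn.last _ _ le_rfl]
    have h1 := p.diag_toPartition hα c
    rw [countLE_top p.β_sub hc, ← p.card_eq, hα, Nat.card_Icc] at h1
    omega
  | pred i hi ih =>
    have h1 := (hn.compat_col i c).1 (by omega)
    rw [ih (by omega)] at h1
    omega

theorem eq_zero_of_le_abs (hα : p.α = Finset.Icc 1 a) (hn : IsPartitionChain a p.toPartition n)
    (i c : ℤ) (hc : ((a + b : ℕ) : ℤ) ≤ |c|) : n i c = 0 := by
  rw [← hn.clamp_eq]
  rcases le_total 0 c with h | h
  · rw [abs_of_nonneg h] at hc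
    push_cast at hc
    exact hn.eq_zero_right hα (by unfold clamp; omega) (by unfold clamp; omega)
  · rw [abs_of_nonpos h] at hc
    push_cast at hc
    exact hn.eq_zero_left (by unfold clamp; omega) (by unfold clamp; omega)

end IsPartitionChain

variable {a b : ℕ} {p : BP a b}

/-- The diagonal sizes `min i j - H i j` of the partitions attached to a height function, with
`j = i + c` in row `i` and for content `c`. -/
def chainOf (a : ℕ) (H : ℤ → ℤ → ℕ) (i c : ℤ) : ℕ :=
  (max 0 (min (clamp a i) (clamp a i + c)) - H (clamp a i) (clamp a i + c)).toNat

theorem IsHeight.le_min {α β : Finset ℕ} {H : ℤ → ℤ → ℕ} (hH : IsHeight a b α β H) {i : ℤ} (j : ℤ)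
    (hi : 0 ≤ i) : (H i j : ℤ) ≤ max 0 (min i j) := by
  have h1 : (H i j : ℤ) ≤ i := by
    induction i, hi using Int.leInduction with
    | base => rw [hH.top _ _ le_rfl]; rfl
    | succ i hi ih =>
      have := hH.down_le i j
      omega
  have h2 : (H i j : ℤ) ≤ max 0 j := by
    rcases le_total j 0 with hj | hj
    · rw [hH.left _ _ hj]; simp
    · induction j, hj using Int.leInduction with
      | base => rw [hH.left _ _ le_rfl]; simp
      | succ j hj ih =>
        have := hH.right_le i j
        have := ih (by have := hH.le_right i j; omega)
        omega
  omega

theorem IsHeight.chainOf_eq {α β : Finset ℕ} {H : ℤ → ℤ → ℕ} (hH : IsHeight a b α β H) {i : ℤ}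
    (c : ℤ) (h0 : 0 ≤ i) (h1 : i ≤ a) :
    (chainOf a H i c : ℤ) = max 0 (min i (i + c)) - H i (i + c) := by
  have := hH.le_min (i + c) h0
  rw [chainOf, clamp_of_mem h0 h1]
  omega

theorem chainOf_clamp (H : ℤ → ℤ → ℕ) (i c : ℤ) : chainOf a H (clamp a i) c = chainOf a H i c := by
  rw [chainOf, chainOf, clamp_of_mem (i := clamp a i) (by unfold clamp; omega)
    (by unfold clamp; omega)]

theorem IsHeight.chainOf_compat_row {α β : Finset ℕ} {H : ℤ → ℤ → ℕ} (hH : IsHeight a b α β H)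
    (i c : ℤ) : Compat c (chainOf a H i (c - 1)) (chainOf a H i c) := by
  rw [← chainOf_clamp H i, ← chainOf_clamp H i]
  have h0 : 0 ≤ clamp a i := by unfold clamp; omega
  have h1 : clamp a i ≤ a := by unfold clamp; omega
  generalize clamp a i = i at *
  have e1 := hH.chainOf_eq c h0 h1
  have e2 := hH.chainOf_eq (c - 1) h0 h1
  have e : i + (c - 1) + 1 = i + c := by ring
  have h2 := hH.le_right i (i + (c - 1))
  have h3 := hH.right_le i (i + (c - 1))
  have h4 := hH.left i (i + c)
  rw [e] at h2 h3
  constructor <;> intro hc <;> omega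

theorem IsHeight.chainOf_isPartitionChain (hα : p.α = Finset.Icc 1 a) {H : ℤ → ℤ → ℕ}
    (hH : IsHeight a b p.α p.β H) : IsPartitionChain a p.toPartition (chainOf a H) where
  zero i c hi := by
    have h := hH.chainOf_eq c le_rfl (Int.natCast_nonneg a)
    rw [hH.top _ _ le_rfl] at h
    rw [← chainOf_clamp, show clamp a i = 0 by unfold clamp; omega]
    omega
  last i c hi := by
    have h := hH.chainOf_eq c (Int.natCast_nonneg a) le_rfl
    rw [hH.bottom _ _ le_rfl] at h
    have h' := p.diag_toPartition hα c
    rw [← chainOf_clamp, show clamp a i = a by unfold clamp; omega]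
    omega
  compat_row := hH.chainOf_compat_row
  compat_col i c := by
    rcases le_or_gt i 0 with h | h
    · rw [← chainOf_clamp H (i - 1), show clamp a (i - 1) = clamp a i by unfold clamp; omega,
        chainOf_clamp]
      exact hH.chainOf_compat_row i c
    rcases lt_or_ge (a : ℤ) i with h' | h'
    · rw [← chainOf_clamp H (i - 1), show clamp a (i - 1) = clamp a i by unfold clamp; omega,
        chainOf_clamp]
      exact hH.chainOf_compat_row i c
    have e1 := hH.chainOf_eq (c - 1) h.le h'
    have e2 := hH.chainOf_eq (i := i - 1) c (by omega) (by omega)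
    have h2 := hH.le_down (i - 1) (i + (c - 1))
    have h3 := hH.down_le (i - 1) (i + (c - 1))
    have h4 := hH.left (i - 1) (i + (c - 1))
    have h5 := hH.left i (i + (c - 1))
    have e : i - 1 + c = i + (c - 1) := by ring
    rw [sub_add_cancel] at h2 h3
    rw [e] at e2
    constructor <;> intro hc <;> omega

theorem IsHeight.changes_chainOf (hα : p.α = Finset.Icc 1 a) {H : ℤ → ℤ → ℕ}
    (hH : IsHeight a b p.α p.β H) :
    changes (chainOf a H) = (fun z : ℤ × ℤ => toLex (z.1, z.2 - z.1)) '' (toggles a b H) := by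
  have hn := hH.chainOf_isPartitionChain hα
  ext w
  constructor
  · obtain ⟨i, c⟩ := w
    intro h
    replace h : chainOf a H i c ≠ chainOf a H (i - 1) c := h
    have hi0 : 1 ≤ i := by
      by_contra hi
      exact h (by rw [hn.zero i c (by omega), hn.zero (i - 1) c (by omega)])
    have hia : i ≤ a := by
      by_contra hi
      exact h (by rw [hn.last i c (by omega), hn.last (i - 1) c (by omega)])
    have hj0 : 1 ≤ i + c := by
      by_contra hi
      exact h (by rw [hn.eq_zero_left (i := i) (by omega) (by omega),
        hn.eq_zero_left (i := i - 1) (by omega) (by omega)])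
    have hjb : i + c ≤ b := by
      by_contra hi
      exact h (by rw [hn.eq_zero_right hα (i := i) (by omega) (by omega),
        hn.eq_zero_right hα (i := i - 1) (by omega) (by omega)])
    refine ⟨(i, i + c), ?_, by simp only [add_sub_cancel_left]; rfl⟩
    simp only [toggles, rect, Finset.coe_filter, Finset.mem_product, Finset.mem_Icc]
    refine ⟨⟨⟨hi0, hia⟩, hj0, hjb⟩, ?_⟩
    have e1 := hH.chainOf_eq (i := i) c (by omega) (by omega)
    have e2 := hH.chainOf_eq (i := i - 1) c (by omega) (by omega)
    rw [show i - 1 + c = i + c - 1 by ring] at e2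
    change H i (i + c) ≠ H (i - 1) (i + c - 1) + 1
    omega
  · rintro ⟨⟨i, j⟩, hz, rfl⟩
    simp only [toggles, rect, Finset.coe_filter, Finset.mem_product, Finset.mem_Icc] at hz
    obtain ⟨⟨⟨hi0, hia⟩, hj0, hjb⟩, hz⟩ := hz
    rw [toLex_mem_changes]
    dsimp only at hz ⊢
    have e1 := hH.chainOf_eq (i := i) (j - i) (by omega) (by omega)
    have e2 := hH.chainOf_eq (i := i - 1) (j - i) (by omega) (by omega)
    rw [show i - 1 + (j - i) = j - 1 by ring] at e2
    rw [show i + (j - i) = j by ring] at e1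
    omega

/-- In the rows from `0` to `a`, the formula `H i j = min i j - n i (j - i)` inverts `chainOf`. -/
theorem IsPartitionChain.exists_height (hα : p.α = Finset.Icc 1 a) {n : ℤ → ℤ → ℕ}
    (hn : IsPartitionChain a p.toPartition n) :
    ∃ H, IsHeight a b p.α p.β H ∧ chainOf a H = n := by
  have hab := p.le_of_α_eq hα
  let h : ℤ → ℤ → ℤ := fun i j => max 0 (min (clamp a i) j) - n i (j - clamp a i)
  have hdown : ∀ i j, h i j ≤ h (i + 1) j ∧ h (i + 1) j ≤ h i j + 1 := by
    intro i j
    rcases lt_or_ge i 0 with h1 | h1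
    · have e : clamp a (i + 1) = clamp a i := by unfold clamp; omega
      have e1 := hn.zero i (j - clamp a i) (by omega)
      have e2 := hn.zero (i + 1) (j - clamp a i) (by omega)
      simp only [h, e]
      omega
    rcases le_or_gt (a : ℤ) i with h2 | h2
    · have e : clamp a (i + 1) = clamp a i := by unfold clamp; omega
      have e1 := hn.last i (j - clamp a i) (by omega)
      have e2 := hn.last (i + 1) (j - clamp a i) (by omega)
      simp only [h, e]
      omega
    simp only [h, clamp_of_mem h1 h2.le, clamp_of_mem (show 0 ≤ i + 1 by omega) h2]
    have h3 := hn.compat_col (i + 1) (j - i)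
    rw [show j - i - 1 = j - (i + 1) by ring, add_sub_cancel_right] at h3
    have h4 := hn.eq_zero_left (i := i) (c := j - i) h1
    have h5 := hn.eq_zero_left (i := i + 1) (c := j - (i + 1)) (by omega)
    obtain ⟨h6, h7⟩ := h3
    omega
  have htop : ∀ i j, i ≤ 0 → h i j = 0 := by
    intro i j hi
    have e1 := hn.zero i (j - clamp a i) hi
    simp only [h]
    unfold clamp at *
    omega
  have hnonneg : ∀ i j, 0 ≤ h i j := by
    intro i j
    rcases le_total i 0 with hi | hi
    · rw [htop i j hi]
    · induction i, hi using Int.leInduction with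
      | base => rw [htop 0 j le_rfl]
      | succ i hi ih => exact ih.trans (hdown i j).1
  have hright : ∀ i j, h i j ≤ h i (j + 1) ∧ h i (j + 1) ≤ h i j + 1 := by
    intro i j
    have h1 : 0 ≤ clamp a i := by unfold clamp; omega
    have h3 := hn.compat_row (clamp a i) (j + 1 - clamp a i)
    rw [show j + 1 - clamp a i - 1 = j - clamp a i by ring] at h3
    have h4 := hn.eq_zero_left (c := j - clamp a i) h1
    have h5 := hn.eq_zero_left (c := j + 1 - clamp a i) h1
    rw [hn.clamp_eq, hn.clamp_eq] at h3
    rw [hn.clamp_eq] at h4 h5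
    obtain ⟨h6, h7⟩ := h3
    simp only [h]
    omega
  have hcast : ∀ i j, ((h i j).toNat : ℤ) = h i j := fun i j => Int.toNat_of_nonneg (hnonneg i j)
  have hH : IsHeight a b p.α p.β fun i j => (h i j).toNat :=
    { le_right := fun i j => Int.toNat_le_toNat (hright i j).1
      right_le := fun i j => by
        have := (hright i j).2
        have := hnonneg i j
        omega
      le_down := fun i j => Int.toNat_le_toNat (hdown i j).1
      down_le := fun i j => by
        have := (hdown i j).2
        have := hnonneg i j
        omega
      top := fun i j hi => by rw [htop i j hi]; rfl
      left := fun i j hj => by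
        have h1 : 0 ≤ clamp a i := by unfold clamp; omega
        have h4 := hn.eq_zero_left (c := j - clamp a i) h1 (by omega)
        rw [hn.clamp_eq] at h4
        simp only [h]
        omega
      bottom := fun i j hi => by
        have e : clamp a i = a := by unfold clamp; omega
        have h1 := p.diag_toPartition hα (j - a)
        have h2 := hn.last i (j - a) hi
        rw [show (a : ℤ) + (j - a) = j by ring] at h1
        simp only [h, e]
        omega
      right := fun i j hj => by
        have h1 : 0 ≤ clamp a i := by unfold clamp; omega
        have h2 : clamp a i ≤ a := by unfold clamp; omega
        have h4 := hn.eq_zero_right hα (i := clamp a i) (c := j - clamp a i) h2 (by omega)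
        rw [hn.clamp_eq] at h4
        have h5 : (countLE p.α i : ℤ) = clamp a i := by
          rcases le_total i 0 with hi | hi
          · rw [countLE_zero p.α_sub hi]; unfold clamp; omega
          rcases le_total (a : ℤ) i with hi' | hi'
          · rw [countLE_top p.α_sub hi', hα, Nat.card_Icc]; unfold clamp; omega
          · rw [hα, countLE_Icc a hi hi', clamp_of_mem hi hi']
        simp only [h]
        omega }
  refine ⟨_, hH, ?_⟩
  funext i c
  rw [← chainOf_clamp, ← hn.clamp_eq]
  have h0 : 0 ≤ clamp a i := by unfold clamp; omega
  have h1 : clamp a i ≤ a := by unfold clamp; omega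
  generalize clamp a i = i at *
  have h2 := hH.chainOf_eq c h0 h1
  have h3 : h i (i + c) = max 0 (min i (i + c)) - n i c := by
    simp only [h, clamp_of_mem h0 h1, add_sub_cancel_left]
  rw [hcast, h3] at h2
  omega

theorem chainOf_bijOn (hα : p.α = Finset.Icc 1 a) (l : ℕ) :
    Set.BijOn (chainOf a) (heights a b p.α p.β l) (chains a p.toPartition l) := by
  have hinj : Function.Injective fun z : ℤ × ℤ => toLex (z.1, z.2 - z.1) := by
    rintro ⟨i, j⟩ ⟨i', j'⟩ h
    have h' : i = i' ∧ j - i = j' - i' := Prod.mk.inj (toLex.injective h)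
    ext <;> simp only <;> omega
  have hcard : ∀ H, IsHeight a b p.α p.β H →
      (changes (chainOf a H)).encard = (toggles a b H).card := by
    intro H hH
    rw [hH.changes_chainOf hα, hinj.encard_image, Set.encard_coe_eq_coe_finsetCard]
  refine ⟨?_, ?_, ?_⟩
  · rintro H ⟨hH, hl⟩
    exact ⟨hH.chainOf_isPartitionChain hα, by rw [hcard H hH, hl]⟩
  · rintro H ⟨hH, -⟩ H' ⟨hH', -⟩ he
    funext i j
    rcases le_total i 0 with hi | hi
    · rw [hH.top i j hi, hH'.top i j hi]
    rcases le_total (a : ℤ) i with hi' | hi'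
    · rw [hH.bottom i j hi', hH'.bottom i j hi']
    have h1 := hH.chainOf_eq (j - i) hi hi'
    have h2 := hH'.chainOf_eq (j - i) hi hi'
    rw [he] at h1
    rw [show i + (j - i) = j by ring] at h1 h2
    omega
  · rintro n ⟨hn, hl⟩
    obtain ⟨H, hH, rfl⟩ := hn.exists_height hα
    exact ⟨H, ⟨hH, by rw [hcard H hH] at hl; exact_mod_cast hl⟩, rfl⟩

end OscPaths

namespace OscPaths

/-! ### Chains of partitions and oscillating tableaux -/

/-- The last row `i` for which `(i, c)` is at most `w` in the lexicographic order. -/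
def lastRow (w : ℤ ×ₗ ℤ) (c : ℤ) : ℤ := if c ≤ (ofLex w).2 then (ofLex w).1 else (ofLex w).1 - 1

theorem toLex_le_iff (i c : ℤ) (w : ℤ ×ₗ ℤ) : toLex (i, c) ≤ w ↔ i ≤ lastRow w c := by
  rw [Prod.Lex.le_iff, lastRow]
  simp only [ofLex_toLex]
  split_ifs <;> omega

theorem lastRow_toLex_of_le {i c d : ℤ} (h : d ≤ c) : lastRow (toLex (i, c)) d = i := if_pos h

theorem lastRow_toLex_of_lt {i c d : ℤ} (h : c < d) : lastRow (toLex (i, c)) d = i - 1 :=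
  if_neg (not_le.2 h)

theorem le_toLex_sub_one_iff (i c : ℤ) (w : ℤ ×ₗ ℤ) : w ≤ toLex (i, c - 1) ↔ w < toLex (i, c) := by
  rw [Prod.Lex.le_iff, Prod.Lex.lt_iff]
  simp only [ofLex_toLex]
  omega

theorem eq_toLex (w : ℤ ×ₗ ℤ) : toLex ((ofLex w).1, (ofLex w).2) = w := rfl

section tableau

variable {a l : ℕ} {ν : YoungDiagram} {η : Fin (l + 1) → YoungDiagram} {t : Fin l → ℤ}

/-- The position, in the lexicographic order of rows and contents, of the `k`-th change. -/
def position (η : Fin (l + 1) → YoungDiagram) (t : Fin l → ℤ) (k : Fin l) : ℤ ×ₗ ℤ :=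
  toLex (t k, profile η k)

/-- The number of changes up to the position `w`. -/
def numChanges (η : Fin (l + 1) → YoungDiagram) (t : Fin l → ℤ) (w : ℤ ×ₗ ℤ) : ℕ :=
  (Finset.univ.filter fun k => position η t k ≤ w).card

theorem numChanges_lt (w : ℤ ×ₗ ℤ) : numChanges η t w < l + 1 :=
  Nat.lt_succ_of_le ((Finset.card_filter_le _ _).trans (by simp))

/-- The partition that an oscillating tableau has reached at the position `w`. -/
def stateAt (η : Fin (l + 1) → YoungDiagram) (t : Fin l → ℤ) (w : ℤ ×ₗ ℤ) : YoungDiagram :=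
  η ⟨numChanges η t w, numChanges_lt w⟩

/-- The chain of partitions made of the stages of an oscillating tableau at the ends of the rows:
after `(i, c)`, row `i` has no further changes of content `c`. -/
def chainOfTableau (η : Fin (l + 1) → YoungDiagram) (t : Fin l → ℤ) (i c : ℤ) : ℕ :=
  diag (stateAt η t (toLex (i, c))) c

theorem lt_numChanges_iff (ht : StrictMono (position η t)) (w : ℤ ×ₗ ℤ) (k : Fin l) :
    (k : ℕ) < numChanges η t w ↔ position η t k ≤ w :=
  (iff_lt_card_filter (fun k => position η t k ≤ w)
    (fun _ _ hk h => (ht.monotone hk).trans h) k).symm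

theorem numChanges_eq (ht : StrictMono (position η t)) {w : ℤ ×ₗ ℤ} {m : ℕ} (hm : m ≤ l)
    (h : ∀ k : Fin l, position η t k ≤ w ↔ (k : ℕ) < m) : numChanges η t w = m := by
  by_contra hne
  have hlt := numChanges_lt (η := η) (t := t) w
  rcases Nat.lt_or_gt_of_ne hne with hlt' | hlt'
  · have := (lt_numChanges_iff ht w ⟨numChanges η t w, by omega⟩).2 ((h _).2 hlt')
    exact lt_irrefl _ this
  · have := (h ⟨m, by omega⟩).1 ((lt_numChanges_iff ht w _).1 hlt')
    exact lt_irrefl _ this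

theorem diag_eq_of_profile_ne (hη : η ∈ OT ν l) (c : ℤ) {m m' : ℕ} (hm : m ≤ m') (hm' : m' < l + 1)
    (h : ∀ k : Fin l, m ≤ k → (k : ℕ) < m' → profile η k ≠ c) :
    diag (η ⟨m, by omega⟩) c = diag (η ⟨m', hm'⟩) c := by
  induction m', hm using Nat.le_induction with
  | base => rfl
  | succ n hn ih =>
    rw [ih (by omega) fun k h1 h2 => h k h1 (by omega)]
    exact ((hη.2.2 ⟨n, by omega⟩).diag_eq (h ⟨n, by omega⟩ hn (Nat.lt_succ_self n)).symm).symm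

/-- On the diagonal of content `c`, the stage at the position `w` only depends on the last row whose
vertex of content `c` has been passed. -/
theorem diag_stateAt (hη : η ∈ OT ν l) (ht : StrictMono (position η t)) (w : ℤ ×ₗ ℤ) (c : ℤ) :
    diag (stateAt η t w) c = chainOfTableau η t (lastRow w c) c := by
  refine (diag_eq_of_profile_ne hη c ?_ _ fun k h1 h2 h3 => ?_).symm
  · refine Finset.card_le_card fun k hk => ?_
    rw [Finset.mem_filter] at hk ⊢
    exact ⟨hk.1, hk.2.trans ((toLex_le_iff _ _ _).2 le_rfl)⟩
  · rw [lt_numChanges_iff ht, position, h3, toLex_le_iff] at h2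
    rw [← not_lt, lt_numChanges_iff ht, position, h3, toLex_le_iff, lastRow_toLex_of_le le_rfl] at h1
    exact h1 h2

theorem isPartitionChain_chainOfTableau (hη : η ∈ OT ν l) (ht : StrictMono (position η t))
    (hta : ∀ k, 1 ≤ t k ∧ t k ≤ a) : IsPartitionChain a ν (chainOfTableau η t) where
  zero i c hi := by
    have h : numChanges η t (toLex (i, c)) = 0 := numChanges_eq ht (Nat.zero_le _) fun k => by
      rw [position, Prod.Lex.toLex_le_toLex]
      have := hta k
      simp only
      omega
    rw [chainOfTableau, stateAt]
    simp only [h]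
    have h0 : η ⟨0, by omega⟩ = ⊥ := hη.1
    rw [h0, diag_bot]
    rfl
  last i c hi := by
    have hlast : η ⟨l, by omega⟩ = ν := hη.2.1
    rw [chainOfTableau, stateAt, ← hlast]
    refine diag_eq_of_profile_ne hη c (Nat.lt_succ_iff.1 (numChanges_lt _)) _
      fun k h1 _ h3 => ?_
    rw [← not_lt, lt_numChanges_iff ht, position, h3, Prod.Lex.toLex_le_toLex] at h1
    have := hta k
    simp only at h1
    omega
  compat_row i c := by
    have h1 := diag_stateAt hη ht (toLex (i, c)) (c - 1)
    rw [lastRow_toLex_of_le (by omega)] at h1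
    rw [← h1]
    exact compat_diag _ _
  compat_col i c := by
    have h1 := diag_stateAt hη ht (toLex (i, c - 1)) c
    rw [lastRow_toLex_of_lt (by omega)] at h1
    rw [← h1]
    exact compat_diag _ _

theorem changes_chainOfTableau (hη : η ∈ OT ν l) (ht : StrictMono (position η t)) :
    changes (chainOfTableau η t) = Set.range (position η t) := by
  ext w
  obtain ⟨i, c, rfl⟩ : ∃ i c, w = toLex (i, c) := ⟨_, _, (eq_toLex w).symm⟩
  have h1 := diag_stateAt hη ht (toLex (i, c - 1)) c
  rw [lastRow_toLex_of_lt (by omega)] at h1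
  rw [toLex_mem_changes, ← h1]
  by_cases hw : toLex (i, c) ∈ Set.range (position η t)
  · simp only [hw, iff_true]
    obtain ⟨k, hk⟩ := hw
    have h2 : numChanges η t (toLex (i, c)) = k + 1 := numChanges_eq ht k.2 fun m => by
      rw [← hk, ht.le_iff_le, Fin.le_def]
      omega
    have h3 : numChanges η t (toLex (i, c - 1)) = k := numChanges_eq ht k.2.le fun m => by
      rw [le_toLex_sub_one_iff, ← hk, ht.lt_iff_lt, Fin.lt_def]
    have hc : profile η k = c := (Prod.mk.inj (toLex.injective hk)).2
    have h4 := (hη.2.2 k).diag_cases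
    change diag (η k.succ) (profile η k) = diag (η k.castSucc) (profile η k) + 1 ∨
      diag (η k.castSucc) (profile η k) = diag (η k.succ) (profile η k) + 1 at h4
    rw [hc] at h4
    have h5 : stateAt η t (toLex (i, c)) = η k.succ := congrArg η (Fin.ext h2)
    have h6 : stateAt η t (toLex (i, c - 1)) = η k.castSucc := congrArg η (Fin.ext h3)
    rw [chainOfTableau, h5, h6]
    omega
  · simp only [hw, iff_false, not_not]
    have h2 : numChanges η t (toLex (i, c)) = numChanges η t (toLex (i, c - 1)) := by
      rw [numChanges, numChanges]
      congr 1
      refine Finset.filter_congr fun k _ => ?_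
      rw [le_toLex_sub_one_iff, lt_iff_le_and_ne]
      exact ⟨fun h => ⟨h, fun he => hw ⟨k, he⟩⟩, fun h => h.1⟩
    rw [chainOfTableau, stateAt, stateAt]
    simp only [h2]

theorem stateAt_position (ht : StrictMono (position η t)) (k : Fin l) :
    stateAt η t (position η t k) = η k.succ := by
  refine congrArg η (Fin.ext (numChanges_eq ht (m := k + 1) k.2 fun m => ?_))
  rw [ht.le_iff_le, Fin.le_def]
  omega

end tableau

/-- The oscillating tableaux of shape `ν` and length `l`, together with compatible rows from `1`
to `a` for their steps. -/
def tableauxWithRows (a : ℕ) (ν : YoungDiagram) (l : ℕ) :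
    Set ((Fin (l + 1) → YoungDiagram) × (Fin l → ℤ)) :=
  {x | x.1 ∈ OT ν l ∧ x.2 ∈ rowSeqs a (profile x.1)}

theorem chainOfTableau_injOn (a : ℕ) (ν : YoungDiagram) (l : ℕ) :
    Set.InjOn (fun x => chainOfTableau x.1 x.2) (tableauxWithRows a ν l) := by
  rintro ⟨η, t⟩ ⟨hη, hta, ht⟩ ⟨η', t'⟩ ⟨hη', hta', ht'⟩ he
  replace ht : StrictMono (position η t) := ht
  replace ht' : StrictMono (position η' t') := ht'
  dsimp only at hη hη' he
  have h1 : position η t = position η' t' := by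
    rw [← StrictMono.range_inj ht ht', ← changes_chainOfTableau hη ht,
      ← changes_chainOfTableau hη' ht', he]
  have h2 : t = t' := by
    funext k
    exact (Prod.mk.inj (toLex.injective (congrFun h1 k))).1
  have h3 : η = η' := by
    funext k
    refine Fin.cases ?_ (fun k => ?_) k
    · rw [hη.1, hη'.1]
    · apply diag_injective
      funext c
      rw [← stateAt_position ht, ← stateAt_position ht', diag_stateAt hη ht, diag_stateAt hη' ht',
        he, h1]
  rw [h2, h3]

/-- The diagonal sizes of the partition reached by a chain at the position `w`. -/
def chainStateAt (n : ℤ → ℤ → ℕ) (w : ℤ ×ₗ ℤ) (c : ℤ) : ℕ := n (lastRow w c) c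

theorem chainStateAt_eq {n : ℤ → ℤ → ℕ} {w w' : ℤ ×ₗ ℤ} {c : ℤ} (hw : w ≤ w')
    (h : ∀ i, w < toLex (i, c) → toLex (i, c) ≤ w' → toLex (i, c) ∉ changes n) :
    chainStateAt n w c = chainStateAt n w' c := by
  have hle : lastRow w c ≤ lastRow w' c := by
    rw [← toLex_le_iff]
    exact ((toLex_le_iff _ _ _).2 le_rfl).trans hw
  have key : ∀ r, lastRow w c ≤ r → r ≤ lastRow w' c → n (lastRow w c) c = n r c := by
    intro r hr
    induction r, hr using Int.leInduction with
    | base => exact fun _ => rfl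
    | succ r hr ih =>
      intro hr'
      have h1 := h (r + 1) (by rw [← not_le, toLex_le_iff]; omega) (by rw [toLex_le_iff]; exact hr')
      rw [toLex_mem_changes, not_not, add_sub_cancel_right] at h1
      rw [ih (by omega), h1]
  exact key _ hle le_rfl

theorem IsPartitionChain.compat_chainStateAt {a : ℕ} {ν : YoungDiagram} {n : ℤ → ℤ → ℕ}
    (hn : IsPartitionChain a ν n) (w : ℤ ×ₗ ℤ) (c : ℤ) :
    Compat c (chainStateAt n w (c - 1)) (chainStateAt n w c) := by
  obtain ⟨i, d, rfl⟩ : ∃ i d, w = toLex (i, d) := ⟨_, _, (eq_toLex w).symm⟩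
  unfold chainStateAt
  rcases le_or_gt c d with h | h
  · rw [lastRow_toLex_of_le h, lastRow_toLex_of_le (by omega)]
    exact hn.compat_row i c
  rw [lastRow_toLex_of_lt h]
  rcases le_or_gt (c - 1) d with h' | h'
  · rw [lastRow_toLex_of_le h']
    exact hn.compat_col i c
  · rw [lastRow_toLex_of_lt h']
    exact hn.compat_row (i - 1) c

theorem IsPartitionChain.row_of_mem_changes {a : ℕ} {ν : YoungDiagram} {n : ℤ → ℤ → ℕ}
    (hn : IsPartitionChain a ν n) {i c : ℤ} (h : toLex (i, c) ∈ changes n) : 1 ≤ i ∧ i ≤ a := by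
  rw [toLex_mem_changes] at h
  constructor
  · by_contra hi
    exact h (by rw [hn.zero i c (by omega), hn.zero (i - 1) c (by omega)])
  · by_contra hi
    exact h (by rw [hn.last i c (by omega), hn.last (i - 1) c (by omega)])

/-- A chain of partitions is refined to an oscillating tableau by performing its changes one at
a time. -/
theorem IsPartitionChain.exists_tableau {a l : ℕ} {ν : YoungDiagram} {n : ℤ → ℤ → ℕ}
    (hn : IsPartitionChain a ν n) (hl : (changes n).encard = l) {N : ℕ}
    (hN : ∀ i c : ℤ, (N : ℤ) ≤ |c| → n i c = 0) :
    ∃ x ∈ tableauxWithRows a ν l, chainOfTableau x.1 x.2 = n := by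
  have hfin := Set.finite_of_encard_eq_coe hl
  have hcard : hfin.toFinset.card = l := by
    rw [hfin.encard_eq_coe_toFinset_card] at hl
    exact_mod_cast hl
  let z := hfin.toFinset.orderEmbOfFin hcard
  have hz : Set.range z = changes n := by simp [z]
  have hzmem : ∀ k, z k ∈ changes n := fun k => hz ▸ Set.mem_range_self k
  have hzrow : ∀ k, 1 ≤ (ofLex (z k)).1 ∧ (ofLex (z k)).1 ≤ a := fun k =>
    hn.row_of_mem_changes (hzmem k)
  choose state hstate using fun w =>
    exists_diag_eq (hn.compat_chainStateAt w) (N := N) fun c hc => hN _ c hc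
  -- `y` lists the changes, preceded by a position before all of them.
  let y : Fin (l + 1) → ℤ ×ₗ ℤ := Fin.cons (toLex (0, 0)) z
  have hy0 : y 0 = toLex (0, 0) := rfl
  have hysucc : ∀ k, y k.succ = z k := fun k => rfl
  have hy : StrictMono y := by
    rw [Fin.strictMono_iff_lt_succ]
    intro k
    rw [hysucc]
    rcases l with _ | l
    · exact k.elim0
    refine Fin.cases ?_ (fun k => ?_) k
    · rw [Fin.castSucc_zero, hy0, Prod.Lex.lt_iff]
      left
      exact (hzrow 0).1
    · rw [← Fin.succ_castSucc, hysucc]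
      exact z.strictMono (Fin.castSucc_lt_succ)
  have hychange : ∀ w ∈ changes n, ∃ k : Fin l, w = y k.succ := by
    intro w hw
    rw [← hz] at hw
    obtain ⟨k, rfl⟩ := hw
    exact ⟨k, rfl⟩
  let η : Fin (l + 1) → YoungDiagram := fun k => state (y k)
  have hdiag : ∀ k c, diag (η k) c = chainStateAt n (y k) c := fun k c =>
    congrFun (hstate (y k)) c
  have hstep : ∀ k : Fin l, DiffBySquare (η k.castSucc) (η k.succ) ∧
      diagDiff (η k.castSucc) (η k.succ) = (ofLex (z k)).2 := by
    intro k
    obtain ⟨i, c, hic⟩ : ∃ i c, z k = toLex (i, c) := ⟨_, _, (eq_toLex _).symm⟩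
    have hlt : y k.castSucc < toLex (i, c) := by
      rw [← hic, ← hysucc]
      exact hy Fin.castSucc_lt_succ
    have hbetween : ∀ w ∈ changes n, y k.castSucc < w → w < toLex (i, c) → False := by
      intro w hw h1 h2
      obtain ⟨m, rfl⟩ := hychange w hw
      rw [← hic, ← hysucc, hy.lt_iff_lt] at h2
      rw [hy.lt_iff_lt] at h1
      rw [Fin.lt_def] at h1 h2
      simp only [Fin.val_succ, Fin.val_castSucc] at h1 h2
      omega
    have hmem : n i c ≠ n (i - 1) c := by
      have := hzmem k
      rwa [hic, toLex_mem_changes] at this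
    rw [hic]
    apply diffBySquare_of_diag
    · have h1 : diag (η k.castSucc) c = n (i - 1) c := by
        rw [hdiag, chainStateAt_eq (w' := toLex (i, c - 1)), chainStateAt,
          lastRow_toLex_of_lt (by omega)]
        · rw [le_toLex_sub_one_iff]
          exact hlt
        · intro i' h1 h2 h3
          rw [le_toLex_sub_one_iff] at h2
          exact hbetween _ h3 h1 h2
      have h2 : diag (η k.succ) c = n i c := by
        rw [hdiag, hysucc, hic, chainStateAt, lastRow_toLex_of_le le_rfl]
      have h3 := hn.compat_row i c
      have h4 := hn.compat_col i c
      obtain ⟨h5, h6⟩ := h3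
      obtain ⟨h7, h8⟩ := h4
      change diag (η k.succ) c = diag (η k.castSucc) c + 1 ∨
        diag (η k.castSucc) c = diag (η k.succ) c + 1
      rw [h1, h2]
      omega
    · intro d hd
      rw [hdiag, hdiag, hysucc, hic]
      refine (chainStateAt_eq hlt.le fun i' h1 h2 h3 => ?_).symm
      refine hbetween _ h3 h1 (lt_of_le_of_ne h2 fun he => hd ?_)
      exact (Prod.mk.inj (toLex.injective he)).2
  have hprofile : ∀ k, profile η k = (ofLex (z k)).2 := fun k => (hstep k).2
  let t : Fin l → ℤ := fun k => (ofLex (z k)).1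
  have hpos : position η t = z := by
    funext k
    rw [position, hprofile, eq_toLex]
  have hmono : StrictMono (position η t) := by
    rw [hpos]
    exact z.strictMono
  have hη : η ∈ OT ν l := by
    refine ⟨?_, ?_, fun k => (hstep k).1⟩
    · apply diag_injective
      funext c
      rw [hdiag, hy0, chainStateAt, diag_bot, hn.zero]
      · rfl
      · rw [lastRow]; split_ifs <;> simp
    · apply diag_injective
      funext c
      have hlast : n a c = chainStateAt n (toLex ((a : ℤ) + 1, c - 1)) c := by
        rw [chainStateAt, lastRow_toLex_of_lt (by omega), add_sub_cancel_right]
      rw [hdiag, ← hn.last a c le_rfl, hlast]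
      refine chainStateAt_eq ?_ fun i h1 _ h3 => ?_
      · rw [Prod.Lex.le_iff]
        left
        refine Fin.cases ?_ (fun k => ?_) (Fin.last l)
        · rw [hy0]
          simp only [ofLex_toLex]
          omega
        · rw [hysucc]
          have := hzrow k
          simp only [ofLex_toLex]
          omega
      · obtain ⟨k, hk⟩ := hychange _ h3
        rw [hk, hy.lt_iff_lt] at h1
        exact absurd h1 (not_lt.2 (Fin.le_last _))
  refine ⟨(η, t), ⟨hη, hzrow, hmono⟩, ?_⟩
  funext i c
  change chainOfTableau η t i c = n i c
  rcases le_or_gt i 0 with hi | hi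
  · rw [(isPartitionChain_chainOfTableau hη hmono hzrow).zero i c hi, hn.zero i c hi]
  · have h1 : n i c = chainStateAt n (toLex (i, c)) c := by
      rw [chainStateAt, lastRow_toLex_of_le le_rfl]
    rw [h1, chainOfTableau, stateAt, hdiag]
    have hiff := lt_numChanges_iff hmono (toLex (i, c))
    rw [hpos] at hiff
    suffices h : ∀ m (hm : m < l + 1), (∀ k : Fin l, (k : ℕ) < m ↔ z k ≤ toLex (i, c)) →
        chainStateAt n (y ⟨m, hm⟩) c = chainStateAt n (toLex (i, c)) c from h _ _ hiff
    clear hiff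
    intro m hm hiff
    refine chainStateAt_eq ?_ fun i' h2 h3 h4 => ?_
    · rcases m with _ | m
      · change toLex ((0 : ℤ), (0 : ℤ)) ≤ _
        rw [Prod.Lex.toLex_le_toLex]
        exact Or.inl hi
      · exact (hiff ⟨m, by omega⟩).1 (Nat.lt_succ_self m)
    · obtain ⟨k, hk⟩ := hychange _ h4
      rw [hk, hysucc, ← hiff] at h3
      rw [hk, hy.lt_iff_lt, Fin.lt_def, Fin.val_succ] at h2
      simp only at h2
      omega

variable {a b : ℕ}

theorem chainOfTableau_bijOn {p : BP a b} (hα : p.α = Finset.Icc 1 a) (l : ℕ) :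
    Set.BijOn (fun x => chainOfTableau x.1 x.2) (tableauxWithRows a p.toPartition l)
      (chains a p.toPartition l) := by
  refine ⟨?_, chainOfTableau_injOn _ _ _, ?_⟩
  · rintro ⟨η, t⟩ ⟨hη, hta, ht⟩
    refine ⟨isPartitionChain_chainOfTableau hη ht hta, ?_⟩
    rw [changes_chainOfTableau hη ht, ← Set.image_univ,
      (show Function.Injective (position η t) from ht.injective).encard_image]
    simp
  · rintro n ⟨hn, hl⟩
    obtain ⟨x, hx, h⟩ := hn.exists_tableau hl (hn.eq_zero_of_le_abs hα)
    exact ⟨x, hx, h⟩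

/-! ### Enumeration -/

theorem tableauxWithRows_finite (a : ℕ) (ν : YoungDiagram) (l : ℕ) :
    (tableauxWithRows a ν l).Finite := by
  refine ((OT_finite ν l).prod
    (Set.Finite.pi' fun _ : Fin l => Set.finite_Icc (1 : ℤ) a)).subset ?_
  rintro ⟨η, t⟩ ⟨hη, ht⟩
  exact ⟨hη, ht.1⟩

/-- The rows of a tableau are counted by `ncard_rowSeqs`; summing over the tableaux gives the
right-hand side of the enumeration formula. -/
theorem ncard_tableauxWithRows (a : ℕ) (ν : YoungDiagram) (l : ℕ) :
    (tableauxWithRows a ν l).ncard = ∑ᶠ η ∈ OT ν l, (a + asc (· < ·) η).choose l := by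
  classical
  rw [finsum_mem_eq_finite_toFinset_sum _ (OT_finite ν l),
    Set.ncard_eq_toFinset_card _ (tableauxWithRows_finite a ν l),
    Finset.card_eq_sum_card_fiberwise (f := Prod.fst) (t := (OT_finite ν l).toFinset)]
  · refine Finset.sum_congr rfl fun η hη => ?_
    rw [Set.Finite.mem_toFinset] at hη
    rw [← ncard_rowSeqs, ← Set.ncard_coe_finset,
      ← Set.ncard_image_of_injective (rowSeqs a (profile η))
        (f := fun t => (η, t)) fun t t' h => (Prod.mk.inj h).2]
    congr 1
    ext ⟨η', t⟩
    simp only [Finset.coe_filter, Set.Finite.mem_toFinset, tableauxWithRows, Set.mem_image]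
    constructor
    · rintro ⟨⟨h1, h2⟩, h3⟩
      dsimp only at h1 h2 h3
      subst h3
      exact ⟨t, h2, rfl⟩
    · rintro ⟨t', h1, h2⟩
      obtain ⟨rfl, rfl⟩ := Prod.mk.inj h2
      exact ⟨⟨hη, h1⟩, rfl⟩
  · rintro ⟨η, t⟩ h
    rw [Set.Finite.coe_toFinset] at h ⊢
    exact h.1

theorem ncard_eq_of_bijOn {X Y : Type*} {s : Set X} {t : Set Y} {f : X → Y}
    (h : Set.BijOn f s t) : s.ncard = t.ncard := by
  rw [← h.image_eq, h.injOn.ncard_image]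

theorem heights_finite_and_ncard {p : BP a b} (hα : p.α = Finset.Icc 1 a) (l : ℕ) :
    (heights a b p.α p.β l).Finite ∧ (heights a b p.α p.β l).ncard =
      ∑ᶠ η ∈ OT p.toPartition l, (a + asc (· < ·) η).choose l := by
  have h1 := chainOf_bijOn hα l
  have h2 := chainOfTableau_bijOn hα l
  refine ⟨?_, ?_⟩
  · refine Set.Finite.of_finite_image ?_ h1.injOn
    rw [h1.image_eq, ← h2.image_eq]
    exact (tableauxWithRows_finite _ _ _).image _
  · rw [ncard_eq_of_bijOn h1, ← ncard_eq_of_bijOn h2, ncard_tableauxWithRows]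

theorem IsHeight.transpose {α β : Finset ℕ} {H : ℤ → ℤ → ℕ} (hH : IsHeight a b α β H) :
    IsHeight b a β α fun i j => H j i where
  le_right i j := hH.le_down j i
  right_le i j := hH.down_le j i
  le_down i j := hH.le_right j i
  down_le i j := hH.right_le j i
  top i j := hH.left j i
  left i j := hH.top j i
  bottom i j := hH.right j i
  right i j := hH.bottom j i

theorem card_toggles_transpose (a b : ℕ) (H : ℤ → ℤ → ℕ) :
    (toggles b a fun i j => H j i).card = (toggles a b H).card := by
  refine Finset.card_bij (fun z _ => z.swap) ?_ ?_ ?_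
  · rintro ⟨i, j⟩ hz
    simp only [toggles, rect, Finset.mem_filter, Finset.mem_product, Prod.swap_prod_mk] at hz ⊢
    tauto
  · rintro z _ z' _ h
    exact Prod.swap_injective h
  · rintro ⟨i, j⟩ hz
    refine ⟨(j, i), ?_, rfl⟩
    simp only [toggles, rect, Finset.mem_filter, Finset.mem_product] at hz ⊢
    tauto

theorem transpose_bijOn_heights (α β : Finset ℕ) (l : ℕ) :
    Set.BijOn (fun H i j => H j i) (heights a b α β l) (heights b a β α l) := by
  refine ⟨?_, ?_, ?_⟩
  · rintro H ⟨hH, hl⟩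
    exact ⟨hH.transpose, by rw [card_toggles_transpose, hl]⟩
  · intro H _ H' _ h
    funext i j
    exact congrFun (congrFun h j) i
  · rintro H ⟨hH, hl⟩
    exact ⟨fun i j => H j i, ⟨hH.transpose, by rw [card_toggles_transpose, hl]⟩, rfl⟩

end OscPaths

theorem corollary17 (a b : ℕ) (ha : 0 < a) (hb : 0 < b) (p : OscPaths.BP a b) (l : ℕ) :
    (p.α = Finset.Icc 1 a →
      (OscPaths.OPl p l).Finite ∧ (OscPaths.OT p.toPartition l).Finite ∧
      (OscPaths.OPl p l).ncard =
        ∑ᶠ η ∈ OscPaths.OT p.toPartition l, (a + OscPaths.asc (· < ·) η).choose l) ∧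
    (p.β = Finset.Icc 1 b →
      (OscPaths.OPl p l).Finite ∧ (OscPaths.OT p.toPartition l).Finite ∧
      (OscPaths.OPl p l).ncard =
        ∑ᶠ η ∈ OscPaths.OT p.toPartition l, (b + OscPaths.asc (· > ·) η).choose l) := by
  have h := OscPaths.height_bijOn p l
  refine ⟨fun hα => ?_, fun hβ => ?_⟩
  · obtain ⟨h1, h2⟩ := OscPaths.heights_finite_and_ncard hα l
    refine ⟨Set.Finite.of_finite_image (h.image_eq ▸ h1) h.injOn, OscPaths.OT_finite _ _, ?_⟩
    rw [OscPaths.ncard_eq_of_bijOn h, h2]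
  · have ht := OscPaths.transpose_bijOn_heights (a := a) (b := b) p.α p.β l
    obtain ⟨h1, h2⟩ := OscPaths.heights_finite_and_ncard (p := p.swap) hβ l
    have h3 : (OscPaths.heights a b p.α p.β l).Finite :=
      Set.Finite.of_finite_image (ht.image_eq.symm ▸ h1) ht.injOn
    refine ⟨Set.Finite.of_finite_image (h.image_eq.symm ▸ h3) h.injOn, OscPaths.OT_finite _ _, ?_⟩
    rw [OscPaths.ncard_eq_of_bijOn h, OscPaths.ncard_eq_of_bijOn ht]
    refine h2.trans ?_
    have hp : p.swap.toPartition.transpose = p.toPartition := by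
      rw [OscPaths.BP.toPartition_swap, YoungDiagram.transpose_transpose]
    rw [← hp]
    refine finsum_mem_eq_of_bijOn _ (OscPaths.transpose_bijOn_OT p.swap.toPartition l)
      fun η hη => ?_
    rw [OscPaths.asc_transpose hη]
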